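/- Let $d\ge 1$ and $s\ge 0$. For $r\in\mathbb{R}$ and a function $g:\mathbb{R}^d\to\mathbb{R}$ let $$\|g\|_{\mathcal{B}^r(\mathbb{R}^d)}=\int_{\mathbb{R}^d}|\hat g(\xi)|\,(1+|\xi|^2)^{r/2}\,d\xi ,\qquad \hat g(\xi)=\frac{1}{(2\pi)^d}\int_{\mathbb{R}^d}g(x)e^{-ix^\top\xi}\,dx ,$$ where $\hat g$ is understood in the sense of tempered distributions and the norm is $\infty$ if $\hat g$ is not a function. Let $\mathcal{B}^r(\mathbb{R}^d)$ be the set of all $g$ (identified when equal almost everywhere) with $\|g\|_{\mathcal{B}^r(\mathbb{R}^d)}<\infty$. Let $V:\mathbb{R}^d\to\mathbb{R}$ satisfy $V(x)\ge 0$ for all $x\in\mathbb{R}^d$ and $V=\alpha+W$ with a constant $\alpha>0$ and $W\in\mathcal{B}^s(\mathbb{R}^d)$. Then there is a constant $C<\infty$, depending only on $V$, $d$ and $s$, such that for every $f\in\mathcal{B}^s(\mathbb{R}^d)$ the Schrödinger equation $$-\Delta u+Vu=f\quad\text{in }\mathbb{R}^d$$ (in the sense of distributions) has a unique solution $u^*\in\mathcal{B}^{s+2}(\mathbb{R}^d)$,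 and $$\|u^*\|_{\mathcal{B}^{s+2}(\mathbb{R}^d)}\le C\,\|f\|_{\mathcal{B}^s(\mathbb{R}^d)}.$$ -/

import Mathlib

open MeasureTheory
open scoped ENNReal NNReal SchwartzMap ContDiff

noncomputable section

namespace SpectralBarron

/-- The Fourier transform `(2π)⁻ᵈ ∫ g(x) e^{-i x·ξ} dx` of a complex function on `ℝᵈ`
(meaningful for integrable `g`; it is applied below to Schwartz functions). -/
def fourierInt {d : ℕ} (g : EuclideanSpace ℝ (Fin d) → ℂ) (ξ : EuclideanSpace ℝ (Fin d)) : ℂ :=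
  (((2 * Real.pi) ^ d : ℝ) : ℂ)⁻¹ * ∫ x, g x * Complex.exp (-(Complex.I * ((inner ℝ x ξ : ℝ) : ℂ)))

/-- `g` is integrable against every Schwartz function, so that `φ ↦ ∫ g φ` is the
tempered distribution represented by `g`. (Testing with a Gaussian shows that such a `g` is a.e.
strongly measurable and locally integrable.) -/
def IsTempered {d : ℕ} (g : EuclideanSpace ℝ (Fin d) → ℂ) : Prop :=
  ∀ φ : 𝓢(EuclideanSpace ℝ (Fin d), ℂ), Integrable (fun x => g x * φ x)

/-- The function `h` is the Fourier transform of the function `g` in the sense of tempered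
distributions: `∫ h φ = ∫ g φ̂` for all Schwartz functions `φ`. Such an `h` is unique up to
a null set. -/
def IsFourierTransform {d : ℕ} (g h : EuclideanSpace ℝ (Fin d) → ℂ) : Prop :=
  IsTempered g ∧ IsTempered h ∧
    ∀ φ : 𝓢(EuclideanSpace ℝ (Fin d), ℂ), ∫ ξ, h ξ * φ ξ = ∫ x, g x * fourierInt (⇑φ) x

/-- The spectral Barron norm `∫ |ĝ(ξ)| (1 + |ξ|²)^{s/2} dξ` of a real function `g`, with values
in `[0, ∞]`. As `ĝ` is unique up to a null set, the infimum is over a single value, or over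
the empty set (with value `∞`) if the Fourier transform of `g` is not a function. -/
def barronNorm {d : ℕ} (s : ℝ) (g : EuclideanSpace ℝ (Fin d) → ℝ) : ℝ≥0∞ :=
  ⨅ (h : EuclideanSpace ℝ (Fin d) → ℂ) (_ : IsFourierTransform (fun x => (g x : ℂ)) h),
    ∫⁻ ξ, ‖h ξ‖ₑ * ENNReal.ofReal ((1 + ‖ξ‖ ^ 2) ^ (s / 2))

/-- The spectral Barron space `𝓑ˢ(ℝᵈ)`: the functions with finite spectral Barron norm. Its
elements are understood up to equality almost everywhere. -/
def barronSpace (d : ℕ) (s : ℝ) : Set (EuclideanSpace ℝ (Fin d) → ℝ) :=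
  {g | barronNorm s g < ⊤}

/-- The assumption on the potential: `V ≥ 0` everywhere, and `V = α + W` with a constant `α > 0`
and `W ∈ 𝓑ˢ(ℝᵈ)`. -/
def PotentialAssumption {d : ℕ} (s : ℝ) (V : EuclideanSpace ℝ (Fin d) → ℝ) : Prop :=
  (∀ x, 0 ≤ V x) ∧
    ∃ α : ℝ, 0 < α ∧ ∃ W ∈ barronSpace d s, ∀ x, V x = α + W x

/-- `u` solves `-Δu + V u = f` on `ℝᵈ` in the sense of distributions. -/
def IsSolution {d : ℕ} (V f u : EuclideanSpace ℝ (Fin d) → ℝ) : Prop :=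
  LocallyIntegrable u ∧ LocallyIntegrable (fun x => V x * u x) ∧ LocallyIntegrable f ∧
    ∀ φ : EuclideanSpace ℝ (Fin d) → ℝ, ContDiff ℝ ∞ φ → HasCompactSupport φ →
      ∫ x, (-(u x * Laplacian.laplacian φ x) + V x * u x * φ x) = ∫ x, f x * φ x

end SpectralBarron

end

/-! Write h, w, k for the Fourier transforms of u, W, f. The equation becomes (|ξ|² + α) h + w ∗ h =
k. With the unknown G = (|ξ|² + α)(1 + |ξ|²)^(s/2) h it reads (1 + T) G = (1 + |ξ|²)^(s/2) k in L¹,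
where T is `potentialOp`. Since (1 + |ξ|²)/(|ξ|² + α) is bounded, G ∈ L¹ already places u in the
space of order s + 2.

The operator T is compact: it integrates G against an L¹-valued kernel that is continuous and,
thanks to the factor 1/(|η|² + α), vanishes at infinity. The kernel therefore has totally bounded
range, and T is a norm limit of finite-rank operators (`isCompactOperator_potentialOp`). By the
Fredholm alternative, 1 + T is invertible as soon as it is injective, and the norm of the inverse
gives C (`exists_solution_operator`).

Injectivity is a maximum principle (`re_invFourierInt_nonpos`). An element of the kernel yields a
continuous u that tends to 0 at infinity by Riemann-Lebesgue and satisfies -Δu + Vu = 0 with V ≥ 0,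
so neither Re u nor Im u can have a positive maximum or a negative minimum. The same argument gives
uniqueness. The linear theory is complex; taking Hermitian parts returns to real functions without
increasing the norm. -/

noncomputable section

namespace SpectralBarron

open Filter Topology FourierTransform

/-! ### Compactness of integral operators on L¹ with Banach-valued kernels -/

section KernelOperator

variable {α E : Type*} [MeasurableSpace α] {μ : Measure α} [NormedAddCommGroup E] [NormedSpace ℂ E]

theorem integrable_smul_of_bound {κ : α → E} (hκ : AEStronglyMeasurable κ μ) {C : ℝ}
    (hC : ∀ a, ‖κ a‖ ≤ C) {G : α → ℂ} (hG : Integrable G μ) :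
    Integrable (fun a => G a • κ a) μ :=
  hG.smul_bdd C hκ (Eventually.of_forall hC)

/-- The operator `G ↦ ∫ G(a) κ(a) dμ(a)` on `L¹(μ)`, for a bounded measurable `κ` with values in a
Banach space. -/
def kernelOp (κ : α → E) (hκ : AEStronglyMeasurable κ μ) (C : ℝ) (hC : ∀ a, ‖κ a‖ ≤ C) :
    Lp ℂ 1 μ →L[ℂ] E :=
  LinearMap.mkContinuous
    { toFun := fun G => ∫ a, G a • κ a ∂μ
      map_add' := fun G H => by
        rw [← integral_add (integrable_smul_of_bound hκ hC (L1.integrable_coeFn G))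
          (integrable_smul_of_bound hκ hC (L1.integrable_coeFn H))]
        refine integral_congr_ae ?_
        filter_upwards [Lp.coeFn_add G H] with a ha
        rw [ha, Pi.add_apply, add_smul]
      map_smul' := fun c G => by
        rw [RingHom.id_apply, ← integral_smul]
        refine integral_congr_ae ?_
        filter_upwards [Lp.coeFn_smul c G] with a ha
        rw [ha, Pi.smul_apply, smul_assoc] }
    C
    (fun G => by
      rw [L1.norm_eq_integral_norm, ← integral_const_mul]
      refine norm_integral_le_of_norm_le ((L1.integrable_coeFn G).norm.const_mul C)
        (Eventually.of_forall fun a => ?_)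
      rw [norm_smul, mul_comm]
      exact mul_le_mul_of_nonneg_right (hC a) (norm_nonneg _))

theorem kernelOp_apply {κ : α → E} (hκ : AEStronglyMeasurable κ μ) {C : ℝ} (hC : ∀ a, ‖κ a‖ ≤ C)
    (G : Lp ℂ 1 μ) : kernelOp κ hκ C hC G = ∫ a, G a • κ a ∂μ := rfl

theorem map_kernelOp [CompleteSpace E] {F : Type*} [NormedAddCommGroup F] [NormedSpace ℂ F]
    [CompleteSpace F] (L : E →L[ℂ] F) {κ : α → E} (hκ : AEStronglyMeasurable κ μ) {C : ℝ}
    (hC : ∀ a, ‖κ a‖ ≤ C) (G : Lp ℂ 1 μ) : L (kernelOp κ hκ C hC G) = ∫ a, G a • L (κ a) ∂μ := by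
  rw [kernelOp_apply, ← ContinuousLinearMap.integral_comp_comm _
    (integrable_smul_of_bound hκ hC (L1.integrable_coeFn G))]
  simp only [map_smul]

/-- Uniform closeness of kernels becomes closeness in operator norm because the domain is L¹. -/
theorem norm_kernelOp_sub_le {κ κ' : α → E} (hκ : AEStronglyMeasurable κ μ)
    (hκ' : AEStronglyMeasurable κ' μ) {C C' ε : ℝ} (hC : ∀ a, ‖κ a‖ ≤ C) (hC' : ∀ a, ‖κ' a‖ ≤ C')
    (hε : 0 ≤ ε) (h : ∀ a, ‖κ a - κ' a‖ ≤ ε) :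
    ‖kernelOp κ hκ C hC - kernelOp κ' hκ' C' hC'‖ ≤ ε := by
  refine ContinuousLinearMap.opNorm_le_bound _ hε fun G => ?_
  rw [sub_apply, kernelOp_apply, kernelOp_apply,
    ← integral_sub (integrable_smul_of_bound hκ hC (L1.integrable_coeFn G))
      (integrable_smul_of_bound hκ' hC' (L1.integrable_coeFn G)),
    L1.norm_eq_integral_norm, ← integral_const_mul]
  refine norm_integral_le_of_norm_le ((L1.integrable_coeFn G).norm.const_mul ε)
    (Eventually.of_forall fun a => ?_)
  rw [← smul_sub, norm_smul, mul_comm]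
  exact mul_le_mul_of_nonneg_right (h a) (norm_nonneg _)

/-- The kernel takes finitely many values, so the operator factors through their finite-dimensional
span, where the identity is compact. -/
theorem isCompactOperator_kernelOp_simpleFunc [CompleteSpace E] (σ : SimpleFunc α E)
    {C : ℝ} (hC : ∀ a, ‖σ a‖ ≤ C) :
    IsCompactOperator (kernelOp (μ := μ) σ σ.aestronglyMeasurable C hC) := by
  classical
  let P : Submodule ℂ E := Submodule.span ℂ (σ.range : Set E)
  have hP : ∀ a, σ a ∈ P := fun a => Submodule.subset_span (by simp)
  have : FiniteDimensional ℂ P := FiniteDimensional.span_of_finite ℂ σ.range.finite_toSet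
  have : ProperSpace P := FiniteDimensional.proper ℂ P
  let τ : SimpleFunc α P := σ.map fun e => if h : e ∈ P then ⟨e, h⟩ else 0
  have hτ : ∀ a, (τ a : E) = σ a := fun a => by simp [τ, hP a]
  have hτC : ∀ a, ‖τ a‖ ≤ C := fun a => by
    have h := hC a
    rwa [← hτ a] at h
  have key : kernelOp (μ := μ) σ σ.aestronglyMeasurable C hC
      = P.subtypeL ∘L kernelOp (μ := μ) τ τ.aestronglyMeasurable C hτC := by
    ext G
    rw [ContinuousLinearMap.comp_apply, kernelOp_apply, map_kernelOp]
    simp [hτ]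
  rw [key]
  exact ((isCompactOperator_id (E := P)).comp_clm
    (kernelOp (μ := μ) τ τ.aestronglyMeasurable C hτC)).clm_comp P.subtypeL

/-- A uniform limit of simple functions gives a compact operator. -/
theorem isCompactOperator_kernelOp [CompleteSpace E] {κ : α → E} (hκ : StronglyMeasurable κ)
    (htb : TotallyBounded (Set.range κ)) {C : ℝ} (hC : ∀ a, ‖κ a‖ ≤ C) :
    IsCompactOperator (kernelOp (μ := μ) κ hκ.aestronglyMeasurable C hC) := by
  borelize E
  refine isClosed_setOfPred_isCompactOperator.closure_subset (Metric.mem_closure_iff.2 ?_)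
  intro ε hε
  obtain ⟨t, ht, hcov⟩ := Metric.totallyBounded_iff.1 htb (ε / 2) (by positivity)
  lift t to Finset E using ht
  -- `nearestPt e N` chooses among `e 0, …, e N`. The index `N` is past the end of the list, so the
  -- default 0 joins the net; an extra point can only shorten distances.
  let e : ℕ → E := fun k => t.toList.getD k 0
  let N := t.toList.length
  let σ : SimpleFunc α E := (SimpleFunc.nearestPt e N).comp κ hκ.measurable
  have hσ : ∀ a, ‖κ a - σ a‖ ≤ ε / 2 := fun a => by
    obtain ⟨y, hy, hay⟩ := Set.mem_iUnion₂.1 (hcov (Set.mem_range_self a))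
    obtain ⟨k, hk, rfl⟩ := List.getElem_of_mem (Finset.mem_toList.2 hy)
    have he : e k = t.toList[k] := List.getD_eq_getElem _ _ hk
    have h := SimpleFunc.edist_nearestPt_le e (κ a) hk.le
    rw [edist_dist, edist_dist, ENNReal.ofReal_le_ofReal_iff dist_nonneg, he, dist_comm,
      dist_comm _ (κ a)] at h
    rw [← dist_eq_norm]
    exact h.trans (Metric.mem_ball.1 hay).le
  have hσC : ∀ a, ‖σ a‖ ≤ C + ε / 2 := fun a => by
    have := norm_sub_le (κ a) (κ a - σ a)
    rw [sub_sub_cancel] at this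
    linarith [hC a, hσ a]
  refine ⟨_, isCompactOperator_kernelOp_simpleFunc (μ := μ) σ hσC, ?_⟩
  rw [dist_eq_norm]
  exact (norm_kernelOp_sub_le _ _ hC hσC (by positivity) hσ).trans_lt (by linarith)

end KernelOperator

/-- Outside a compact set the values lie in one ball around 0, and the image of the compact set has
a finite net. -/
theorem totallyBounded_range_of_tendsto_zero {X E : Type*} [NormedAddCommGroup E] [TopologicalSpace X]
    {κ : X → E}
   
    (hκ : Continuous κ) (h0 : Tendsto κ (cocompact X) (𝓝 0)) : TotallyBounded (Set.range κ) := by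
  refine Metric.totallyBounded_iff.2 fun ε hε => ?_
  obtain ⟨K, hK, hKε⟩ := mem_cocompact.1 (h0 (Metric.ball_mem_nhds 0 hε))
  obtain ⟨t, ht, hcov⟩ := Metric.totallyBounded_iff.1 (hK.image hκ).totallyBounded ε hε
  refine ⟨insert 0 t, ht.insert 0, ?_⟩
  rintro _ ⟨x, rfl⟩
  by_cases hx : x ∈ K
  · exact Set.biUnion_subset_biUnion_left (Set.subset_insert 0 t)
      (hcov (Set.mem_image_of_mem κ hx))
  · exact Set.mem_biUnion (Set.mem_insert 0 t) (hKε hx)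

/-! ### The inverse Fourier transform of integrable functions -/

variable {d : ℕ}

/-- The inverse Fourier transform `∫ h(ξ) e^{i x·ξ} dξ`. -/
def invFourierInt (h : EuclideanSpace ℝ (Fin d) → ℂ) (x : EuclideanSpace ℝ (Fin d)) : ℂ :=
  ∫ ξ, h ξ * Complex.exp (Complex.I * ((inner ℝ x ξ : ℝ) : ℂ))

theorem norm_exp_I_mul_ofReal (t : ℝ) : ‖Complex.exp (Complex.I * (t : ℂ))‖ = 1 := by
  rw [mul_comm, Complex.norm_exp_ofReal_mul_I]

theorem integrable_mul_exp {h : EuclideanSpace ℝ (Fin d) → ℂ} (hh : Integrable h)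
    (x : EuclideanSpace ℝ (Fin d)) :
    Integrable fun ξ => h ξ * Complex.exp (Complex.I * ((inner ℝ x ξ : ℝ) : ℂ)) :=
  hh.mul_bdd (c := 1) (Continuous.aestronglyMeasurable (by fun_prop))
    (Eventually.of_forall fun ξ => (norm_exp_I_mul_ofReal _).le)

theorem norm_invFourierInt_le (h : EuclideanSpace ℝ (Fin d) → ℂ) (x : EuclideanSpace ℝ (Fin d)) :
    ‖invFourierInt h x‖ ≤ ∫ ξ, ‖h ξ‖ := by
  refine (norm_integral_le_integral_norm _).trans_eq (integral_congr_ae (Eventually.of_forall ?_))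
  intro ξ
  simp

theorem continuous_invFourierInt {h : EuclideanSpace ℝ (Fin d) → ℂ} (hh : Integrable h) :
    Continuous (invFourierInt h) := by
  refine continuous_of_dominated (bound := fun ξ => ‖h ξ‖) (fun x => (integrable_mul_exp hh x).1)
    (fun x => Eventually.of_forall fun ξ => ?_) hh.norm (Eventually.of_forall fun ξ => by fun_prop)
  simp

theorem invFourierInt_add {h k : EuclideanSpace ℝ (Fin d) → ℂ} (hh : Integrable h)
    (hk : Integrable k) : invFourierInt (h + k) = invFourierInt h + invFourierInt k := by
  ext x
  rw [Pi.add_apply, invFourierInt, invFourierInt, invFourierInt,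
    ← integral_add (integrable_mul_exp hh x) (integrable_mul_exp hk x)]
  simp [add_mul]

theorem invFourierInt_const_mul (c : ℂ) (h : EuclideanSpace ℝ (Fin d) → ℂ)
    (x : EuclideanSpace ℝ (Fin d)) :
    invFourierInt (fun ξ => c * h ξ) x = c * invFourierInt h x := by
  simp only [invFourierInt, mul_assoc, integral_const_mul]

theorem invFourierInt_congr_ae {h k : EuclideanSpace ℝ (Fin d) → ℂ} (hhk : h =ᵐ[volume] k) :
    invFourierInt h = invFourierInt k := by
  ext x
  refine integral_congr_ae ?_
  filter_upwards [hhk] with ξ hξ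
  rw [hξ]

/-- The Riemann-Lebesgue lemma. -/
theorem tendsto_invFourierInt_cocompact (h : EuclideanSpace ℝ (Fin d) → ℂ) :
    Tendsto (invFourierInt h) (cocompact _) (𝓝 0) := by
  -- Rescaling by -1/(2π) passes from the character e^{-2πi⟨·,·⟩} to e^{i⟨·,·⟩}.
  have hpi : (-(2 * Real.pi)⁻¹ : ℝ) ≠ 0 := by simp [Real.pi_ne_zero]
  have h1 := (tendsto_integral_exp_inner_smul_cocompact h).comp
    (Homeomorph.smulOfNeZero (α := EuclideanSpace ℝ (Fin d)) _ hpi).isClosedEmbedding.tendsto_cocompact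
  refine h1.congr fun x => ?_
  simp only [Function.comp, invFourierInt]
  refine integral_congr_ae (Eventually.of_forall fun ξ => ?_)
  simp only [Homeomorph.smulOfNeZero_apply, inner_smul_right, Circle.smul_def, smul_eq_mul,
    Real.fourierChar_apply]
  rw [mul_comm, real_inner_comm]
  congr 2
  have : (Real.pi : ℂ) ≠ 0 := by exact_mod_cast Real.pi_ne_zero
  push_cast
  field_simp

/-- Fubini: the inverse Fourier transform is symmetric. -/
theorem integral_invFourierInt_mul {h k : EuclideanSpace ℝ (Fin d) → ℂ} (hh : Integrable h)
    (hk : Integrable k) :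
    ∫ x, invFourierInt h x * k x = ∫ ξ, h ξ * invFourierInt k ξ := by
  simp only [invFourierInt, ← integral_mul_const, ← integral_const_mul]
  rw [integral_integral_swap]
  · refine integral_congr_ae (Eventually.of_forall fun ξ =>
      integral_congr_ae (Eventually.of_forall fun x => ?_))
    simp only [real_inner_comm x ξ]
    ring
  · have := (hk.mul_prod hh).mul_bdd (g := fun p : EuclideanSpace ℝ (Fin d) × EuclideanSpace ℝ (Fin d)
      => Complex.exp (Complex.I * ((inner ℝ p.1 p.2 : ℝ) : ℂ)))
      (c := 1) (Continuous.aestronglyMeasurable (by fun_prop))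
      (Eventually.of_forall fun p => (norm_exp_I_mul_ofReal _).le)
    refine this.congr (Eventually.of_forall fun p => ?_)
    simp only [Function.uncurry]
    ring

/-! ### Fourier inversion on Schwartz functions in the (2π)⁻ᵈ normalisation -/

section Schwartz

/-- Dilation of Schwartz functions by a nonzero real number. -/
def dilate (r : ℝ) (hr : r ≠ 0) :
    𝓢(EuclideanSpace ℝ (Fin d), ℂ) →L[ℂ] 𝓢(EuclideanSpace ℝ (Fin d), ℂ) :=
  SchwartzMap.compCLMOfContinuousLinearEquiv ℂ
    (ContinuousLinearEquiv.smulLeft (Units.mk0 r hr) :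
      EuclideanSpace ℝ (Fin d) ≃L[ℝ] EuclideanSpace ℝ (Fin d))

theorem dilate_apply (r : ℝ) (hr : r ≠ 0) (φ : 𝓢(EuclideanSpace ℝ (Fin d), ℂ))
    (x : EuclideanSpace ℝ (Fin d)) : dilate r hr φ x = φ (r • x) := rfl

theorem inv_two_pi_ne_zero : (2 * Real.pi)⁻¹ ≠ 0 := inv_ne_zero Real.two_pi_pos.ne'

theorem dilate_fourierInv (ψ : 𝓢(EuclideanSpace ℝ (Fin d), ℂ)) (ξ : EuclideanSpace ℝ (Fin d)) :
    dilate (2 * Real.pi)⁻¹ inv_two_pi_ne_zero (𝓕⁻ ψ) ξ = invFourierInt ψ ξ := by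
  rw [dilate_apply, SchwartzMap.fourierInv_coe, Real.fourierInv_eq', invFourierInt]
  refine integral_congr_ae (Eventually.of_forall fun x => ?_)
  have : (Real.pi : ℂ) ≠ 0 := by exact_mod_cast Real.pi_ne_zero
  simp only [inner_smul_right, smul_eq_mul, real_inner_comm x ξ]
  rw [mul_comm]
  congr 2
  push_cast
  field_simp

/-- The Jacobian (2π)ᵈ of the dilation cancels the prefactor in `fourierInt`, so inversion for `𝓕`
carries over. -/
theorem fourierInt_dilate_fourierInv (ψ : 𝓢(EuclideanSpace ℝ (Fin d), ℂ))
    (x : EuclideanSpace ℝ (Fin d)) :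
    fourierInt (dilate (2 * Real.pi)⁻¹ inv_two_pi_ne_zero (𝓕⁻ ψ)) x = ψ x := by
  have h2 : (2 * Real.pi) ≠ 0 := Real.two_pi_pos.ne'
  have hcv := Measure.integral_comp_smul (volume : Measure (EuclideanSpace ℝ (Fin d)))
    (fun ζ => 𝓕⁻ ψ ζ * Complex.exp (-(Complex.I * ((2 * Real.pi * inner ℝ ζ x : ℝ) : ℂ))))
    (2 * Real.pi)⁻¹
  have hψ : 𝓕 (𝓕⁻ ψ) x = ψ x := by simp
  rw [SchwartzMap.fourier_coe, Real.fourier_eq'] at hψ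
  rw [fourierInt, ← hψ]
  have e1 : ∫ ξ, dilate (2 * Real.pi)⁻¹ inv_two_pi_ne_zero (𝓕⁻ ψ) ξ
      * Complex.exp (-(Complex.I * ((inner ℝ ξ x : ℝ) : ℂ)))
      = ∫ ξ, (fun ζ => 𝓕⁻ ψ ζ * Complex.exp (-(Complex.I * ((2 * Real.pi * inner ℝ ζ x : ℝ) : ℂ))))
        ((2 * Real.pi)⁻¹ • ξ) := by
    refine integral_congr_ae (Eventually.of_forall fun ξ => ?_)
    simp only [dilate_apply, inner_smul_left, conj_trivial, mul_inv_cancel_left₀ h2]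
  rw [e1, hcv, finrank_euclideanSpace_fin, abs_of_pos (by positivity), inv_pow, inv_inv,
    Complex.real_smul, inv_mul_cancel_left₀ (by exact_mod_cast (pow_pos Real.two_pi_pos d).ne')]
  refine integral_congr_ae (Eventually.of_forall fun ζ => ?_)
  simp only [smul_eq_mul]
  rw [mul_comm]
  congr 2
  push_cast
  ring

/-- With `exists_invFourierInt_eq`, this lets the duality defining `IsFourierTransform` be tested
with an arbitrary Schwartz function on either side. -/
theorem exists_fourierInt_eq (ψ : 𝓢(EuclideanSpace ℝ (Fin d), ℂ)) :
    ∃ φ : 𝓢(EuclideanSpace ℝ (Fin d), ℂ), fourierInt φ = ψ ∧ ⇑φ = invFourierInt ψ :=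
  ⟨_, funext (fourierInt_dilate_fourierInv ψ), funext (dilate_fourierInv ψ)⟩

theorem exists_invFourierInt_eq (φ : 𝓢(EuclideanSpace ℝ (Fin d), ℂ)) :
    ∃ ψ : 𝓢(EuclideanSpace ℝ (Fin d), ℂ), fourierInt φ = ψ ∧ ⇑φ = invFourierInt ψ := by
  obtain ⟨ψ, rfl⟩ : ∃ ψ, dilate (2 * Real.pi)⁻¹ inv_two_pi_ne_zero (𝓕⁻ ψ) = φ := by
    refine ⟨𝓕 (dilate (2 * Real.pi) Real.two_pi_pos.ne' φ), ?_⟩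
    ext x
    rw [FourierTransform.fourierInv_fourier_eq, dilate_apply, dilate_apply, smul_smul,
      mul_inv_cancel₀ Real.two_pi_pos.ne', one_smul]
  exact ⟨ψ, funext (fourierInt_dilate_fourierInv ψ), funext (dilate_fourierInv ψ)⟩

theorem invFourierInt_laplacian (ψ : 𝓢(EuclideanSpace ℝ (Fin d), ℂ))
    (ξ : EuclideanSpace ℝ (Fin d)) :
    invFourierInt (Laplacian.laplacian ψ) ξ = -((‖ξ‖ ^ 2 : ℝ) : ℂ) * invFourierInt ψ ξ := by
  rw [← dilate_fourierInv, ← dilate_fourierInv, dilate_apply, dilate_apply,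
    SchwartzMap.fourierInv_coe, SchwartzMap.fourierInv_coe, Real.fourierInv_eq_fourier_neg,
    Real.fourierInv_eq_fourier_neg, ← SchwartzMap.fourier_coe, ← SchwartzMap.fourier_coe,
    SchwartzMap.laplacian_eq_fourierMultiplierCLM, SchwartzMap.fourierMultiplierCLM_apply,
    FourierTransform.fourier_smul, FourierTransform.fourier_fourierInv_eq, smul_apply,
    SchwartzMap.smulLeftCLM_apply_apply (by fun_prop)]
  have : (Real.pi : ℂ) ≠ 0 := by exact_mod_cast Real.pi_ne_zero
  simp only [norm_neg, norm_smul, mul_pow, Complex.real_smul]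
  rw [Real.norm_of_nonneg (by positivity)]
  push_cast
  field_simp

end Schwartz

/-! ### Tempered Fourier transforms with integrable density -/

section Tempered

/-- A real test function as a complex Schwartz function. -/
def testFunction (φ : EuclideanSpace ℝ (Fin d) → ℝ) (hφ : ContDiff ℝ ∞ φ)
    (hφc : HasCompactSupport φ) : 𝓢(EuclideanSpace ℝ (Fin d), ℂ) :=
  HasCompactSupport.toSchwartzMap (f := fun x => (φ x : ℂ))
    (hφc.comp_left (g := fun t : ℝ => (t : ℂ)) Complex.ofReal_zero)
    (Complex.ofRealCLM.contDiff.comp hφ)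

theorem testFunction_apply (φ : EuclideanSpace ℝ (Fin d) → ℝ) (hφ : ContDiff ℝ ∞ φ)
    (hφc : HasCompactSupport φ) (x : EuclideanSpace ℝ (Fin d)) :
    testFunction φ hφ hφc x = (φ x : ℂ) := rfl

theorem IsTempered.locallyIntegrable {g : EuclideanSpace ℝ (Fin d) → ℂ} (hg : IsTempered g) :
    LocallyIntegrable g := by
  intro x
  let b : ContDiffBump x := default
  have h := hg (testFunction b b.contDiff b.hasCompactSupport)
  refine ⟨Metric.closedBall x b.rIn, Metric.closedBall_mem_nhds x b.rIn_pos, ?_⟩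
  refine h.integrableOn.congr_fun (fun y hy => ?_) measurableSet_closedBall
  simp [testFunction_apply, b.one_of_mem_closedBall hy]

/-- Smooth compactly supported functions are Schwartz, so the fundamental lemma of the calculus of
variations applies. -/
theorem IsTempered.ae_eq {g₁ g₂ : EuclideanSpace ℝ (Fin d) → ℂ} (h₁ : IsTempered g₁)
    (h₂ : IsTempered g₂)
    (h : ∀ φ : 𝓢(EuclideanSpace ℝ (Fin d), ℂ), ∫ x, g₁ x * φ x = ∫ x, g₂ x * φ x) :
    g₁ =ᵐ[volume] g₂ := by
  refine ae_eq_of_integral_contDiff_smul_eq h₁.locallyIntegrable h₂.locallyIntegrable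
    fun φ hφ hφc => ?_
  simpa [testFunction_apply, mul_comm] using h (testFunction φ hφ hφc)

theorem isTempered_of_integrable {h : EuclideanSpace ℝ (Fin d) → ℂ} (hh : Integrable h) :
    IsTempered h := fun φ =>
  hh.mul_bdd (c := ‖φ.toBoundedContinuousFunction‖) φ.continuous.aestronglyMeasurable
    (Eventually.of_forall fun x => φ.toBoundedContinuousFunction.norm_coe_le_norm x)

theorem isTempered_of_bounded {g : EuclideanSpace ℝ (Fin d) → ℂ}
    (hg : AEStronglyMeasurable g volume) {C : ℝ} (hC : ∀ᵐ x, ‖g x‖ ≤ C) : IsTempered g :=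
  fun φ => φ.integrable.bdd_mul hg hC

theorem isFourierTransform_of_ae_eq {g h : EuclideanSpace ℝ (Fin d) → ℂ} (hh : Integrable h)
    (hg : g =ᵐ[volume] invFourierInt h) : IsFourierTransform g h := by
  refine ⟨isTempered_of_bounded
    ((continuous_invFourierInt hh).aestronglyMeasurable.congr hg.symm) (C := ∫ ξ, ‖h ξ‖) ?_,
    isTempered_of_integrable hh, fun φ => ?_⟩
  · filter_upwards [hg] with x hx
    rw [hx]
    exact norm_invFourierInt_le h x
  · obtain ⟨ψ, h1, h2⟩ := exists_invFourierInt_eq φ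
    rw [h1, h2, ← integral_invFourierInt_mul hh ψ.integrable]
    refine integral_congr_ae ?_
    filter_upwards [hg] with x hx
    rw [hx]

/-- Fubini moves the inverse transform onto the test function, which identifies both sides as the
same distribution. This supplies a continuous representative. -/
theorem IsFourierTransform.ae_eq_invFourierInt {g h : EuclideanSpace ℝ (Fin d) → ℂ}
    (hgh : IsFourierTransform g h) (hh : Integrable h) : g =ᵐ[volume] invFourierInt h := by
  refine hgh.1.ae_eq (isTempered_of_bounded (continuous_invFourierInt hh).aestronglyMeasurable
    (Eventually.of_forall (norm_invFourierInt_le h))) fun ψ => ?_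
  obtain ⟨φ, h1, h2⟩ := exists_fourierInt_eq ψ
  rw [integral_invFourierInt_mul hh ψ.integrable, ← h2, hgh.2.2 φ, h1]

theorem IsFourierTransform.unique {g h k : EuclideanSpace ℝ (Fin d) → ℂ}
    (hh : IsFourierTransform g h) (hk : IsFourierTransform g k) : h =ᵐ[volume] k :=
  hh.2.1.ae_eq hk.2.1 fun φ => by rw [hh.2.2, hk.2.2]

theorem ae_eq_zero_of_invFourierInt_eq_zero {h : EuclideanSpace ℝ (Fin d) → ℂ} (hh : Integrable h)
    (h0 : ∀ x, invFourierInt h x = 0) : h =ᵐ[volume] 0 := by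
  refine (isFourierTransform_of_ae_eq hh (EventuallyEq.refl _ _)).unique
    (isFourierTransform_of_ae_eq (integrable_zero _ _ _) (Eventually.of_forall fun x => ?_))
  rw [h0]
  simp [invFourierInt]

/-- The inverse Fourier transform turns multiplication by `-‖ξ‖²` into the weak Laplacian. -/
theorem integral_invFourierInt_mul_laplacian {h : EuclideanSpace ℝ (Fin d) → ℂ}
    (hh : Integrable h) (hh2 : Integrable fun ξ => ((‖ξ‖ ^ 2 : ℝ) : ℂ) * h ξ)
    {φ : EuclideanSpace ℝ (Fin d) → ℝ} (hφ : ContDiff ℝ ∞ φ) (hφc : HasCompactSupport φ) :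
    ∫ x, invFourierInt h x * ((Laplacian.laplacian φ x : ℝ) : ℂ)
      = -∫ x, invFourierInt (fun ξ => ((‖ξ‖ ^ 2 : ℝ) : ℂ) * h ξ) x * (φ x : ℂ) := by
  have hL : ∀ x, Laplacian.laplacian (testFunction φ hφ hφc) x
      = ((Laplacian.laplacian φ x : ℝ) : ℂ) := fun x => by
    rw [SchwartzMap.laplacian_apply]
    exact ContDiffAt.laplacian_CLM_comp_left (l := Complex.ofRealCLM)
      (contDiff_infty.1 hφ 2).contDiffAt
  simp only [← hL, ← testFunction_apply φ hφ hφc]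
  rw [integral_invFourierInt_mul hh (Laplacian.laplacian (testFunction φ hφ hφc)).integrable,
    integral_invFourierInt_mul hh2 (testFunction φ hφ hφc).integrable, ← integral_neg]
  refine integral_congr_ae (Eventually.of_forall fun ξ => ?_)
  simp only [invFourierInt_laplacian]
  ring

end Tempered

/-! ### The Barron weight and weighted integrability -/

section Weight

/-- The weight `(1 + ‖ξ‖²)^(r/2)`. -/
def weight (r : ℝ) (ξ : EuclideanSpace ℝ (Fin d)) : ℝ := (1 + ‖ξ‖ ^ 2) ^ (r / 2)

theorem weight_pos (r : ℝ) (ξ : EuclideanSpace ℝ (Fin d)) : 0 < weight r ξ :=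
  Real.rpow_pos_of_pos (by positivity) _

theorem one_le_weight {r : ℝ} (hr : 0 ≤ r) (ξ : EuclideanSpace ℝ (Fin d)) : 1 ≤ weight r ξ :=
  Real.one_le_rpow (by nlinarith [sq_nonneg ‖ξ‖]) (by positivity)

theorem continuous_weight (r : ℝ) : Continuous (weight (d := d) r) :=
  Continuous.rpow_const (by fun_prop) fun ξ => Or.inl (by positivity)

theorem weight_neg (r : ℝ) (ξ : EuclideanSpace ℝ (Fin d)) : weight r (-ξ) = weight r ξ := by
  simp [weight]

theorem weight_add_two (r : ℝ) (ξ : EuclideanSpace ℝ (Fin d)) :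
    weight (r + 2) ξ = (1 + ‖ξ‖ ^ 2) * weight r ξ := by
  rw [weight, weight, add_div, div_self two_ne_zero, Real.rpow_add_one (by positivity), mul_comm]

/-- A Peetre-type inequality, from 1 + |ξ + η|² ≤ 2(1 + |ξ|²)(1 + |η|²). It is what makes
convolution with `w` bounded on weighted L¹. -/
theorem weight_le_mul {r : ℝ} (hr : 0 ≤ r) (ξ η : EuclideanSpace ℝ (Fin d)) :
    weight r (ξ + η) ≤ 2 ^ (r / 2) * weight r ξ * weight r η := by
  rw [weight, weight, weight, ← Real.mul_rpow (by positivity) (by positivity),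
    ← Real.mul_rpow (by positivity) (by positivity)]
  refine Real.rpow_le_rpow (by positivity) ?_ (by positivity)
  have h := norm_add_le ξ η
  have h2 : ‖ξ + η‖ ^ 2 ≤ (‖ξ‖ + ‖η‖) ^ 2 := pow_le_pow_left₀ (norm_nonneg _) h 2
  nlinarith [sq_nonneg (‖ξ‖ - ‖η‖), mul_nonneg (sq_nonneg ‖ξ‖) (sq_nonneg ‖η‖)]

theorem integrable_of_weight_mul {r : ℝ} (hr : 0 ≤ r) {h : EuclideanSpace ℝ (Fin d) → ℂ}
    (hh : Integrable fun ξ => (weight r ξ : ℂ) * h ξ) : Integrable h := by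
  have hm : AEStronglyMeasurable h volume := by
    have := ((Complex.continuous_ofReal.comp (continuous_weight (d := d) r)).inv₀
      fun ξ => by simpa using (weight_pos r ξ).ne').aestronglyMeasurable.mul hh.1
    refine this.congr (Eventually.of_forall fun ξ => ?_)
    have : (weight r ξ : ℂ) ≠ 0 := by exact_mod_cast (weight_pos r ξ).ne'
    simp [this]
  refine hh.mono hm (Eventually.of_forall fun ξ => ?_)
  rw [norm_mul, Complex.norm_real, Real.norm_of_nonneg (weight_pos r ξ).le]
  exact le_mul_of_one_le_left (norm_nonneg _) (one_le_weight hr ξ)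

theorem enorm_mul_weight (r : ℝ) (z : ℂ) (ξ : EuclideanSpace ℝ (Fin d)) :
    ‖z‖ₑ * ENNReal.ofReal ((1 + ‖ξ‖ ^ 2) ^ (r / 2)) = ‖(weight r ξ : ℂ) * z‖ₑ := by
  rw [enorm_mul, mul_comm, ← ofReal_norm (weight r ξ : ℂ), Complex.norm_real,
    Real.norm_of_nonneg (weight_pos r ξ).le, weight]

theorem barronNorm_eq {r : ℝ} {g : EuclideanSpace ℝ (Fin d) → ℝ}
    {h : EuclideanSpace ℝ (Fin d) → ℂ} (hgh : IsFourierTransform (fun x => (g x : ℂ)) h) :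
    barronNorm r g = ∫⁻ ξ, ‖(weight r ξ : ℂ) * h ξ‖ₑ := by
  simp only [barronNorm, enorm_mul_weight]
  refine le_antisymm (iInf₂_le h hgh) (le_iInf₂ fun k hk => (lintegral_congr_ae ?_).le)
  filter_upwards [hgh.unique hk] with ξ hξ
  rw [hξ]

theorem mem_barronSpace_iff {r : ℝ} {g : EuclideanSpace ℝ (Fin d) → ℝ} :
    g ∈ barronSpace d r ↔ ∃ h : EuclideanSpace ℝ (Fin d) → ℂ,
      IsFourierTransform (fun x => (g x : ℂ)) h ∧ Integrable fun ξ => (weight r ξ : ℂ) * h ξ := by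
  constructor
  · intro hg
    obtain ⟨h, hh⟩ := iInf_lt_iff.1 (show barronNorm r g < ⊤ from hg)
    obtain ⟨hgh, hlt⟩ := iInf_lt_iff.1 hh
    refine ⟨h, hgh, ?_, ?_⟩
    · exact (Complex.continuous_ofReal.comp (continuous_weight r)).aestronglyMeasurable.mul
        hgh.2.1.locallyIntegrable.aestronglyMeasurable
    · rw [HasFiniteIntegral]
      simpa only [enorm_mul_weight] using hlt
  · rintro ⟨h, hgh, hi⟩
    rw [barronSpace, Set.mem_ofPred_eq, barronNorm_eq hgh]
    exact hi.2

end Weight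

/-! ### The maximum principle by second differences -/

section MaximumPrinciple

/-- The symbol of the second difference quotient of step `t`, summed over the coordinate
directions. -/
def secondDiffSymbol (t : ℝ) (ξ : EuclideanSpace ℝ (Fin d)) : ℝ :=
  ∑ i, ξ i ^ 2 * Real.sinc (t * ξ i / 2) ^ 2

theorem continuous_secondDiffSymbol (t : ℝ) : Continuous (secondDiffSymbol (d := d) t) := by
  unfold secondDiffSymbol
  have := Real.continuous_sinc
  fun_prop

theorem secondDiffSymbol_nonneg (t : ℝ) (ξ : EuclideanSpace ℝ (Fin d)) :
    0 ≤ secondDiffSymbol t ξ := Finset.sum_nonneg fun i _ => by positivity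

theorem secondDiffSymbol_zero (ξ : EuclideanSpace ℝ (Fin d)) :
    secondDiffSymbol 0 ξ = ‖ξ‖ ^ 2 := by
  simp [secondDiffSymbol, EuclideanSpace.real_norm_sq_eq]

theorem secondDiffSymbol_le (t : ℝ) (ξ : EuclideanSpace ℝ (Fin d)) :
    secondDiffSymbol t ξ ≤ ‖ξ‖ ^ 2 := by
  rw [← secondDiffSymbol_zero]
  refine Finset.sum_le_sum fun i _ => ?_
  rw [zero_mul, zero_div, Real.sinc_zero, one_pow]
  refine mul_le_mul_of_nonneg_left ?_ (sq_nonneg _)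
  rw [sq_le_one_iff_abs_le_one]
  exact Real.abs_sinc_le_one _

theorem two_mul_cos_sub_two (t a : ℝ) :
    2 * Real.cos (t * a) - 2 = -(t ^ 2 * (a ^ 2 * Real.sinc (t * a / 2) ^ 2)) := by
  have h : t * a / 2 * Real.sinc (t * a / 2) = Real.sin (t * a / 2) := by
    rcases eq_or_ne (t * a / 2) 0 with h0 | h0
    · simp [h0]
    · rw [Real.sinc_of_ne_zero h0, mul_div_cancel₀ _ h0]
  have h2 : Real.cos (t * a) = 1 - 2 * Real.sin (t * a / 2) ^ 2 := by
    have := Real.cos_two_mul' (t * a / 2)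
    rw [mul_div_cancel₀ _ two_ne_zero] at this
    rw [this, Real.cos_sq']
    ring
  rw [h2, ← h]
  ring

theorem integrable_symbol_mul {h : EuclideanSpace ℝ (Fin d) → ℂ} (hh : Integrable h)
    (hh2 : Integrable fun ξ => ((‖ξ‖ ^ 2 : ℝ) : ℂ) * h ξ) (t : ℝ) :
    Integrable fun ξ => (secondDiffSymbol t ξ : ℂ) * h ξ := by
  refine hh2.mono ((Complex.continuous_ofReal.comp
    (continuous_secondDiffSymbol t)).aestronglyMeasurable.mul hh.1) (Eventually.of_forall fun ξ => ?_)
  simp only [norm_mul, Complex.norm_real]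
  rw [Real.norm_of_nonneg (secondDiffSymbol_nonneg t ξ), Real.norm_of_nonneg (sq_nonneg _)]
  exact mul_le_mul_of_nonneg_right (secondDiffSymbol_le t ξ) (norm_nonneg _)

/-- A second difference multiplies e^{ix·ξ} by 2cos(tξᵢ) - 2. Writing this with `sinc` extracts the
factor t², leaving a symbol continuous in t that equals |ξ|² at t = 0. -/
theorem sum_secondDiff_invFourierInt {h : EuclideanSpace ℝ (Fin d) → ℂ} (hh : Integrable h)
    (x : EuclideanSpace ℝ (Fin d)) (t : ℝ) :
    ∑ i, (invFourierInt h (x + EuclideanSpace.single i t)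
        + invFourierInt h (x - EuclideanSpace.single i t) - 2 * invFourierInt h x)
      = -(t ^ 2 : ℝ) * invFourierInt (fun ξ => (secondDiffSymbol t ξ : ℂ) * h ξ) x := by
  have hi : ∀ i : Fin d, Integrable fun ξ =>
      h ξ * Complex.exp (Complex.I * ((inner ℝ (x + EuclideanSpace.single i t) ξ : ℝ) : ℂ))
      + h ξ * Complex.exp (Complex.I * ((inner ℝ (x - EuclideanSpace.single i t) ξ : ℝ) : ℂ))
      - 2 * (h ξ * Complex.exp (Complex.I * ((inner ℝ x ξ : ℝ) : ℂ))) := fun i =>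
    ((integrable_mul_exp hh _).add (integrable_mul_exp hh _)).sub
      ((integrable_mul_exp hh x).const_mul 2)
  have e : ∀ i : Fin d, invFourierInt h (x + EuclideanSpace.single i t)
        + invFourierInt h (x - EuclideanSpace.single i t) - 2 * invFourierInt h x
      = ∫ ξ, (h ξ * Complex.exp (Complex.I * ((inner ℝ (x + EuclideanSpace.single i t) ξ : ℝ) : ℂ))
      + h ξ * Complex.exp (Complex.I * ((inner ℝ (x - EuclideanSpace.single i t) ξ : ℝ) : ℂ))
      - 2 * (h ξ * Complex.exp (Complex.I * ((inner ℝ x ξ : ℝ) : ℂ)))) := fun i => by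
    rw [integral_sub, integral_add, integral_const_mul]
    · rfl
    · exact integrable_mul_exp hh _
    · exact integrable_mul_exp hh _
    · exact (integrable_mul_exp hh _).add (integrable_mul_exp hh _)
    · exact (integrable_mul_exp hh x).const_mul 2
  simp_rw [e]
  rw [← integral_finsetSum _ fun i _ => hi i, invFourierInt, ← integral_const_mul]
  refine integral_congr_ae (Eventually.of_forall fun ξ => ?_)
  simp only [secondDiffSymbol, Complex.ofReal_sum, Finset.sum_mul, Finset.mul_sum]
  refine Finset.sum_congr rfl fun i _ => ?_
  have hc := congrArg (fun r : ℝ => (r : ℂ)) (two_mul_cos_sub_two t (ξ i))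
  simp only [Complex.ofReal_sub, Complex.ofReal_mul, Complex.ofReal_neg, Complex.ofReal_cos,
    Complex.ofReal_pow, Complex.ofReal_ofNat] at hc
  rw [Complex.cos] at hc
  simp only [inner_add_left, inner_sub_left, EuclideanSpace.inner_single_left, conj_trivial,
    Complex.ofReal_add, Complex.ofReal_sub, Complex.ofReal_mul, Complex.ofReal_pow, mul_add,
    mul_sub, Complex.exp_add, Complex.exp_sub]
  rw [mul_comm Complex.I ((t : ℂ) * ξ i)]
  rw [neg_mul, Complex.exp_neg] at hc
  rw [div_eq_mul_inv]
  linear_combination (h ξ * Complex.exp (Complex.I * ((inner ℝ x ξ : ℝ) : ℂ))) * hc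

theorem tendsto_invFourierInt_symbol {h : EuclideanSpace ℝ (Fin d) → ℂ} (hh : Integrable h)
    (hh2 : Integrable fun ξ => ((‖ξ‖ ^ 2 : ℝ) : ℂ) * h ξ) (x : EuclideanSpace ℝ (Fin d)) :
    Tendsto (fun t => invFourierInt (fun ξ => (secondDiffSymbol t ξ : ℂ) * h ξ) x) (𝓝 0)
      (𝓝 (invFourierInt (fun ξ => ((‖ξ‖ ^ 2 : ℝ) : ℂ) * h ξ) x)) := by
  have hc : Continuous fun t => invFourierInt (fun ξ => (secondDiffSymbol t ξ : ℂ) * h ξ) x := by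
    refine continuous_of_dominated (bound := fun ξ => ‖((‖ξ‖ ^ 2 : ℝ) : ℂ) * h ξ‖)
      (fun t => (integrable_mul_exp (integrable_symbol_mul hh hh2 t) x).1)
      (fun t => Eventually.of_forall fun ξ => ?_) hh2.norm (Eventually.of_forall fun ξ => ?_)
    · simp only [norm_mul, norm_exp_I_mul_ofReal, Complex.norm_real, mul_one]
      rw [Real.norm_of_nonneg (secondDiffSymbol_nonneg t ξ), Real.norm_of_nonneg (sq_nonneg _)]
      exact mul_le_mul_of_nonneg_right (secondDiffSymbol_le t ξ) (norm_nonneg _)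
    · have := Real.continuous_sinc
      unfold secondDiffSymbol
      fun_prop
  have := hc.tendsto 0
  simpa only [secondDiffSymbol_zero] using this

/-- The maximum principle for `-Δu + q u = 0` with `q ≥ 0`, for `u` vanishing at infinity. -/
theorem re_invFourierInt_nonpos (hd : 1 ≤ d) {h : EuclideanSpace ℝ (Fin d) → ℂ} (hh : Integrable h)
    (hh2 : Integrable fun ξ => ((‖ξ‖ ^ 2 : ℝ) : ℂ) * h ξ) {q : EuclideanSpace ℝ (Fin d) → ℝ}
    (hq : ∀ x, 0 ≤ q x)
    (heq : ∀ x, invFourierInt (fun ξ => ((‖ξ‖ ^ 2 : ℝ) : ℂ) * h ξ) x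
      + (q x : ℂ) * invFourierInt h x = 0) (x₀ : EuclideanSpace ℝ (Fin d)) :
    (invFourierInt h x₀).re ≤ 0 := by
  by_contra! hpos
  set u : EuclideanSpace ℝ (Fin d) → ℝ := fun x => (invFourierInt h x).re with hu
  have huc : Continuous u := Complex.continuous_re.comp (continuous_invFourierInt hh)
  set M := u x₀ with hM
  replace hpos : 0 < M := hpos
  obtain ⟨R, hR0, hR⟩ : ∃ R : ℝ, 0 < R ∧ ∀ x, R ≤ ‖x‖ → u x < M / 2 := by
    have h1 : ∀ᶠ x in cocompact (EuclideanSpace ℝ (Fin d)), ‖invFourierInt h x‖ < M / 2 :=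
      (tendsto_zero_iff_norm_tendsto_zero.1 (tendsto_invFourierInt_cocompact h)).eventually_lt_const
        (by positivity)
    rw [← Metric.cobounded_eq_cocompact, ← comap_norm_atTop, eventually_comap] at h1
    obtain ⟨R, hR⟩ := eventually_atTop.1 h1
    exact ⟨max R 1, by positivity, fun x hx => ((Complex.re_le_norm _).trans_lt
      (hR ‖x‖ ((le_max_left _ _).trans hx) x rfl))⟩
  -- The perturbation ε|x|² is at most M/4 on the ball. As u < M/2 on the boundary sphere, the
  -- perturbed function stays below M there and its maximum is interior.
  obtain ⟨ε, hε, hεR⟩ : ∃ ε : ℝ, 0 < ε ∧ ε * R ^ 2 = M / 4 :=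
    ⟨M / 4 / R ^ 2, by positivity, by field_simp⟩
  have hx₀ : ‖x₀‖ < R := by
    by_contra! hx
    linarith [hR x₀ hx]
  obtain ⟨y, hy, hmax⟩ := (isCompact_closedBall (0 : EuclideanSpace ℝ (Fin d)) R).exists_isMaxOn
    ⟨x₀, by simpa using hx₀.le⟩ (f := fun x => u x + ε * ‖x‖ ^ 2) (by fun_prop)
  have hyR : ‖y‖ ≤ R := by simpa using hy
  have hyM : M ≤ u y + ε * ‖y‖ ^ 2 := by
    have := hmax (show x₀ ∈ Metric.closedBall 0 R by simpa using hx₀.le)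
    simp only [Set.mem_ofPred_eq] at this
    nlinarith [mul_nonneg hε.le (sq_nonneg ‖x₀‖)]
  have hy2 : ε * ‖y‖ ^ 2 ≤ M / 4 := by
    rw [← hεR]
    gcongr
  have hylt : ‖y‖ < R := by
    by_contra! hy'
    linarith [hR y hy']
  -- At the maximum y of u + ε|x|² second differences are nonpositive, and ε|x|² contributes exactly
  -- 2εt² in each direction. Dividing by t² and letting t → 0 gives -Δu(y) ≥ 2dε without
  -- differentiating u.
  have hlim : 2 * d * ε ≤ (invFourierInt (fun ξ => ((‖ξ‖ ^ 2 : ℝ) : ℂ) * h ξ) y).re := by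
    refine ge_of_tendsto ((Complex.continuous_re.tendsto _).comp
      ((tendsto_invFourierInt_symbol hh hh2 y).mono_left (nhdsWithin_le_nhds (s := {0}ᶜ)))) ?_
    have hsmall : ∀ᶠ t : ℝ in 𝓝[≠] 0, |t| < R - ‖y‖ :=
      nhdsWithin_le_nhds ((continuous_abs.tendsto' 0 0 abs_zero).eventually_lt_const (by linarith))
    filter_upwards [hsmall, self_mem_nhdsWithin] with t ht ht0
    have hpt : ∀ i : Fin d, u (y + EuclideanSpace.single i t) + u (y - EuclideanSpace.single i t)
        - 2 * u y ≤ -(2 * ε * t ^ 2) := fun i => by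
      have hn : ‖EuclideanSpace.single i t‖ = |t| := by simp
      have h1 := hmax (show y + EuclideanSpace.single i t ∈ Metric.closedBall 0 R by
        rw [mem_closedBall_zero_iff]
        linarith [norm_add_le y (EuclideanSpace.single i t)])
      have h2 := hmax (show y - EuclideanSpace.single i t ∈ Metric.closedBall 0 R by
        rw [mem_closedBall_zero_iff]
        linarith [norm_sub_le y (EuclideanSpace.single i t)])
      simp only [Set.mem_ofPred_eq] at h1 h2
      have h3 := parallelogram_law_with_norm ℝ y (EuclideanSpace.single i t)
      rw [hn, sq_abs] at h3
      linear_combination h1 + h2 - ε * h3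
    have hsum := Finset.sum_le_sum fun i (_ : i ∈ Finset.univ) => hpt i
    have hid := congrArg Complex.re (sum_secondDiff_invFourierInt hh y t)
    simp only [Complex.re_sum, Complex.sub_re, Complex.add_re, ← Complex.ofReal_neg,
      Complex.re_ofReal_mul] at hid
    have h2re : ∀ z : ℂ, (2 * z).re = 2 * z.re := fun z => by simp
    simp only [h2re] at hid
    simp only [hu] at hsum
    rw [hid] at hsum
    simp only [Finset.sum_const, Finset.card_univ, Fintype.card_fin, nsmul_eq_mul] at hsum
    have ht2 : 0 < t ^ 2 := by
      have : t ≠ 0 := ht0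
      positivity
    simp only [Function.comp]
    refine le_of_mul_le_mul_left (a := t ^ 2) ?_ ht2
    linarith
  have hre := congrArg Complex.re (heq y)
  simp only [Complex.add_re, Complex.re_ofReal_mul, Complex.zero_re] at hre
  have hd' : (1 : ℝ) ≤ d := by exact_mod_cast hd
  have huy : 0 ≤ q y * (invFourierInt h y).re :=
    mul_nonneg (hq y) (show 0 ≤ u y by linarith)
  -- Here u(y) ≥ 3M/4 > 0, so q(y)u(y) ≥ 0, while -Δu(y) ≥ 2dε > 0 because d ≥ 1; their sum cannot
  -- vanish.
  nlinarith

/-- The equation is linear over ℂ, so the one-sided bound applies to u, -u, iu and -iu. -/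
theorem ae_eq_zero_of_schrodinger_eq_zero (hd : 1 ≤ d) {h : EuclideanSpace ℝ (Fin d) → ℂ}
    (hh : Integrable h) (hh2 : Integrable fun ξ => ((‖ξ‖ ^ 2 : ℝ) : ℂ) * h ξ)
    {q : EuclideanSpace ℝ (Fin d) → ℝ} (hq : ∀ x, 0 ≤ q x)
    (heq : ∀ x, invFourierInt (fun ξ => ((‖ξ‖ ^ 2 : ℝ) : ℂ) * h ξ) x
      + (q x : ℂ) * invFourierInt h x = 0) : h =ᵐ[volume] 0 := by
  have key : ∀ (c : ℂ) x, (c * invFourierInt h x).re ≤ 0 := fun c x => by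
    rw [← invFourierInt_const_mul]
    have hmul : (fun ξ => ((‖ξ‖ ^ 2 : ℝ) : ℂ) * (c * h ξ))
        = fun ξ => c * (((‖ξ‖ ^ 2 : ℝ) : ℂ) * h ξ) := by
      ext ξ
      ring
    refine re_invFourierInt_nonpos hd (hh.const_mul c) ?_ hq (fun y => ?_) x
    · rw [hmul]
      exact hh2.const_mul c
    · rw [hmul, invFourierInt_const_mul, invFourierInt_const_mul, mul_left_comm, ← mul_add, heq,
        mul_zero]
  refine ae_eq_zero_of_invFourierInt_eq_zero hh fun x => Complex.ext ?_ ?_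
  · have h1 := key 1 x
    have h2 := key (-1) x
    simp at h1 h2
    exact le_antisymm h1 h2
  · have h1 := key Complex.I x
    have h2 := key (-Complex.I) x
    simp at h1 h2
    exact le_antisymm h2 h1

end MaximumPrinciple

/-! ### The compact operator on L¹ and the Fredholm alternative -/

section Kernel

variable {s α : ℝ} {w : EuclideanSpace ℝ (Fin d) → ℂ}

theorem norm_weight_add_mul_le (hs : 0 ≤ s) (w : EuclideanSpace ℝ (Fin d) → ℂ)
    (ζ η : EuclideanSpace ℝ (Fin d)) :
    ‖(weight s (ζ + η) : ℂ) * w ζ‖ ≤ 2 ^ (s / 2) * weight s η * ‖(weight s ζ : ℂ) * w ζ‖ := by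
  rw [norm_mul, norm_mul, Complex.norm_real, Complex.norm_real,
    Real.norm_of_nonneg (weight_pos _ _).le, Real.norm_of_nonneg (weight_pos _ _).le]
  calc weight s (ζ + η) * ‖w ζ‖ ≤ (2 ^ (s / 2) * weight s ζ * weight s η) * ‖w ζ‖ :=
        mul_le_mul_of_nonneg_right (weight_le_mul hs ζ η) (norm_nonneg _)
    _ = _ := by ring

theorem integrable_weight_add_mul (hs : 0 ≤ s) (hw : Integrable fun ξ => (weight s ξ : ℂ) * w ξ)
    (η : EuclideanSpace ℝ (Fin d)) : Integrable fun ζ => (weight s (ζ + η) : ℂ) * w ζ := by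
  refine (hw.norm.const_mul (2 ^ (s / 2) * weight s η)).mono' ?_
    (Eventually.of_forall fun ζ => norm_weight_add_mul_le hs w ζ η)
  exact (Complex.continuous_ofReal.comp ((continuous_weight s).comp
    (continuous_id.add continuous_const))).aestronglyMeasurable.mul (integrable_of_weight_mul hs hw).1

/-- The function `ζ ↦ weight s (ζ + η) w(ζ)` as an element of `L¹`. -/
def shiftedWeight (hs : 0 ≤ s) (hw : Integrable fun ξ => (weight s ξ : ℂ) * w ξ)
    (η : EuclideanSpace ℝ (Fin d)) : Lp ℂ 1 (volume : Measure (EuclideanSpace ℝ (Fin d))) :=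
  (integrable_weight_add_mul hs hw η).toL1 _

theorem norm_shiftedWeight_le (hs : 0 ≤ s) (hw : Integrable fun ξ => (weight s ξ : ℂ) * w ξ)
    (η : EuclideanSpace ℝ (Fin d)) :
    ‖shiftedWeight hs hw η‖ ≤ 2 ^ (s / 2) * weight s η * ∫ ζ, ‖(weight s ζ : ℂ) * w ζ‖ := by
  rw [shiftedWeight, L1.norm_of_fun_eq_integral_norm, ← integral_const_mul]
  exact integral_mono (integrable_weight_add_mul hs hw η).norm (hw.norm.const_mul _)
    fun ζ => norm_weight_add_mul_le hs w ζ η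

/-- Only the weight depends on η, so dominated convergence suffices; the translation of `w` is added
later as a group action on L¹. -/
theorem continuous_shiftedWeight (hs : 0 ≤ s)
    (hw : Integrable fun ξ => (weight s ξ : ℂ) * w ξ) : Continuous (shiftedWeight hs hw) := by
  refine continuous_iff_continuousAt.2 fun η₀ => ?_
  rw [ContinuousAt, tendsto_iff_norm_sub_tendsto_zero]
  have e : ∀ η, ‖shiftedWeight hs hw η - shiftedWeight hs hw η₀‖
      = ∫ ζ, ‖(weight s (ζ + η) : ℂ) * w ζ - (weight s (ζ + η₀) : ℂ) * w ζ‖ := fun η => by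
    rw [shiftedWeight, shiftedWeight, ← Integrable.toL1_sub, L1.norm_of_fun_eq_integral_norm]
    rfl
  simp_rw [e]
  have hcw := continuous_weight (d := d) s
  have key : ContinuousAt (fun η =>
      ∫ ζ, ‖(weight s (ζ + η) : ℂ) * w ζ - (weight s (ζ + η₀) : ℂ) * w ζ‖) η₀ := by
    refine continuousAt_of_dominated (bound := fun ζ =>
      2 ^ (s / 2) * (weight s η₀ + 1) * ‖(weight s ζ : ℂ) * w ζ‖
        + ‖(weight s (ζ + η₀) : ℂ) * w ζ‖) (Eventually.of_forall fun η => ?_) ?_ ?_ ?_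
    · exact ((integrable_weight_add_mul hs hw η).sub (integrable_weight_add_mul hs hw η₀)).norm.1
    -- Near η₀ the weight is at most its value there plus 1, which gives a dominating function
    -- independent of η.
    · filter_upwards [(hcw.tendsto η₀).eventually_le_const (lt_add_one _)] with η hη
      refine Eventually.of_forall fun ζ => ?_
      rw [norm_norm]
      refine (norm_sub_le _ _).trans (add_le_add_left ?_ _)
      refine (norm_weight_add_mul_le hs w ζ η).trans ?_
      gcongr
    · exact (hw.norm.const_mul _).add (integrable_weight_add_mul hs hw η₀).norm
    · exact Eventually.of_forall fun ζ => by fun_prop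
  simpa using key.tendsto

/-- The inverse of the symbol `(‖η‖² + α) weight s η`. -/
def resolventSymbol (s α : ℝ) (η : EuclideanSpace ℝ (Fin d)) : ℝ :=
  ((‖η‖ ^ 2 + α) * weight s η)⁻¹

theorem resolventSymbol_pos (hα : 0 < α) (η : EuclideanSpace ℝ (Fin d)) :
    0 < resolventSymbol s α η :=
  inv_pos.2 (mul_pos (by positivity) (weight_pos s η))

theorem continuous_resolventSymbol (hα : 0 < α) :
    Continuous (resolventSymbol (d := d) s α) := by
  have := continuous_weight (d := d) s
  exact Continuous.inv₀ (by fun_prop) fun η => (mul_pos (by positivity) (weight_pos s η)).ne'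

/-- This is the gain of two orders: 1 + t ≤ (1 + α⁻¹)(t + α) for t ≥ 0. -/
theorem weight_add_two_mul_resolventSymbol_le (hα : 0 < α) (η : EuclideanSpace ℝ (Fin d)) :
    weight (s + 2) η * resolventSymbol s α η ≤ 1 + α⁻¹ := by
  have hw := weight_pos s η
  have h : 0 < ‖η‖ ^ 2 + α := by positivity
  have e : weight (s + 2) η * resolventSymbol s α η = (1 + ‖η‖ ^ 2) / (‖η‖ ^ 2 + α) := by
    rw [weight_add_two, resolventSymbol]
    field_simp
  rw [e, div_le_iff₀ h]
  have : 0 ≤ α⁻¹ * ‖η‖ ^ 2 := by positivity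
  have h2 : α⁻¹ * α = 1 := inv_mul_cancel₀ hα.ne'
  nlinarith

/-- The kernel `k_η(ξ) = weight s ξ · w(ξ - η) / ((‖η‖² + α) weight s η)` of the conjugated
convolution operator, as an `L¹`-valued function of `η`. -/
def potentialKernel (α : ℝ) (hs : 0 ≤ s) (hw : Integrable fun ξ => (weight s ξ : ℂ) * w ξ)
    (η : EuclideanSpace ℝ (Fin d)) : Lp ℂ 1 (volume : Measure (EuclideanSpace ℝ (Fin d))) :=
  (resolventSymbol s α η : ℂ) • (DomAddAct.mk (-η) +ᵥ shiftedWeight hs hw η)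

theorem potentialKernel_ae_eq (hs : 0 ≤ s) (hw : Integrable fun ξ => (weight s ξ : ℂ) * w ξ)
    (η : EuclideanSpace ℝ (Fin d)) :
    potentialKernel α hs hw η =ᵐ[volume]
      fun ξ => (resolventSymbol s α η : ℂ) * ((weight s ξ : ℂ) * w (ξ - η)) := by
  have h1 := Lp.coeFn_smul (resolventSymbol s α η : ℂ)
    (DomAddAct.mk (-η) +ᵥ shiftedWeight hs hw η)
  have h2 : (DomAddAct.mk (-η) +ᵥ shiftedWeight hs hw η :
      Lp ℂ 1 (volume : Measure (EuclideanSpace ℝ (Fin d))))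
      =ᵐ[volume] fun ξ => (weight s ((-η +ᵥ ξ) + η) : ℂ) * w (-η +ᵥ ξ) := by
    rw [shiftedWeight, Integrable.toL1, DomAddAct.mk_vadd_toLp]
    exact MemLp.coeFn_toLp _
  filter_upwards [h1, h2] with ξ hξ1 hξ2
  rw [potentialKernel, hξ1, Pi.smul_apply, hξ2, smul_eq_mul, vadd_eq_add, neg_add_cancel_comm,
    neg_add_eq_sub]

theorem continuous_potentialKernel (hα : 0 < α) (hs : 0 ≤ s)
    (hw : Integrable fun ξ => (weight s ξ : ℂ) * w ξ) :
    Continuous (potentialKernel α hs hw) := by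
  have : Fact ((1 : ℝ≥0∞) ≠ ⊤) := ⟨ENNReal.one_ne_top⟩
  have h1 := continuous_shiftedWeight hs hw
  have h2 : Continuous fun η : EuclideanSpace ℝ (Fin d) => DomAddAct.mk (-η) :=
    DomAddAct.continuous_mk.comp continuous_neg
  exact (Complex.continuous_ofReal.comp (continuous_resolventSymbol hα)).smul (h2.vadd h1)

/-- The growth `weight s η` of the shifted weight cancels against `resolventSymbol`, and the
remaining decay in η is what yields compactness. -/
theorem norm_potentialKernel_le (hα : 0 < α) (hs : 0 ≤ s)
    (hw : Integrable fun ξ => (weight s ξ : ℂ) * w ξ) (η : EuclideanSpace ℝ (Fin d)) :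
    ‖potentialKernel α hs hw η‖
      ≤ (‖η‖ ^ 2 + α)⁻¹ * (2 ^ (s / 2) * ∫ ζ, ‖(weight s ζ : ℂ) * w ζ‖) := by
  rw [potentialKernel, norm_smul, Complex.norm_real,
    Real.norm_of_nonneg (resolventSymbol_pos hα η).le, DomAddAct.norm_vadd_Lp]
  refine (mul_le_mul_of_nonneg_left (norm_shiftedWeight_le hs hw η)
    (resolventSymbol_pos hα η).le).trans_eq ?_
  have := (weight_pos s η).ne'
  rw [resolventSymbol]
  field_simp

theorem norm_potentialKernel_le_const (hα : 0 < α) (hs : 0 ≤ s)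
    (hw : Integrable fun ξ => (weight s ξ : ℂ) * w ξ) (η : EuclideanSpace ℝ (Fin d)) :
    ‖potentialKernel α hs hw η‖ ≤ α⁻¹ * (2 ^ (s / 2) * ∫ ζ, ‖(weight s ζ : ℂ) * w ζ‖) := by
  refine (norm_potentialKernel_le hα hs hw η).trans ?_
  gcongr
  exact le_add_of_nonneg_left (sq_nonneg _)

theorem tendsto_potentialKernel (hα : 0 < α) (hs : 0 ≤ s)
    (hw : Integrable fun ξ => (weight s ξ : ℂ) * w ξ) :
    Tendsto (potentialKernel α hs hw) (cocompact _) (𝓝 0) := by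
  refine squeeze_zero_norm (norm_potentialKernel_le hα hs hw) ?_
  have h1 : Tendsto (fun η : EuclideanSpace ℝ (Fin d) => ‖η‖ ^ 2 + α) (cocompact _) atTop :=
    tendsto_atTop_add_const_right _ _
      ((tendsto_pow_atTop two_ne_zero).comp tendsto_norm_cocompact_atTop)
  simpa using h1.inv_tendsto_atTop.mul_const
    (2 ^ (s / 2) * ∫ ζ, ‖(weight s ζ : ℂ) * w ζ‖)

/-- The operator `G ↦ weight s · (w ∗ (G / ((‖·‖² + α) weight s)))` on `L¹`. -/
def potentialOp (hα : 0 < α) (hs : 0 ≤ s) (hw : Integrable fun ξ => (weight s ξ : ℂ) * w ξ) :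
    Lp ℂ 1 (volume : Measure (EuclideanSpace ℝ (Fin d))) →L[ℂ]
      Lp ℂ 1 (volume : Measure (EuclideanSpace ℝ (Fin d))) :=
  kernelOp (potentialKernel α hs hw)
    (continuous_potentialKernel hα hs hw).stronglyMeasurable.aestronglyMeasurable _
    (norm_potentialKernel_le_const hα hs hw)

theorem isCompactOperator_potentialOp (hα : 0 < α) (hs : 0 ≤ s)
    (hw : Integrable fun ξ => (weight s ξ : ℂ) * w ξ) :
    IsCompactOperator (potentialOp hα hs hw) :=
  isCompactOperator_kernelOp (continuous_potentialKernel hα hs hw).stronglyMeasurable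
    (totallyBounded_range_of_tendsto_zero (continuous_potentialKernel hα hs hw)
      (tendsto_potentialKernel hα hs hw)) _

/-- The weighted inverse Fourier transform `G ↦ ∫ G(ξ) e^{i x·ξ} / weight s ξ dξ` at `x`, as a
functional on `L¹`. -/
def evalOp (hs : 0 ≤ s) (x : EuclideanSpace ℝ (Fin d)) :
    Lp ℂ 1 (volume : Measure (EuclideanSpace ℝ (Fin d))) →L[ℂ] ℂ :=
  kernelOp (fun ξ => ((weight s ξ)⁻¹ : ℝ) * Complex.exp (Complex.I * ((inner ℝ x ξ : ℝ) : ℂ)))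
    (Continuous.aestronglyMeasurable (((Complex.continuous_ofReal.comp
      ((continuous_weight s).inv₀ fun ξ => (weight_pos s ξ).ne'))).mul (by fun_prop))) 1
    (fun ξ => by
      rw [norm_mul, norm_exp_I_mul_ofReal, mul_one, Complex.norm_real,
        Real.norm_of_nonneg (inv_pos.2 (weight_pos s ξ)).le]
      exact inv_le_one_of_one_le₀ (one_le_weight hs ξ))

theorem evalOp_apply (hs : 0 ≤ s) (x : EuclideanSpace ℝ (Fin d))
    (G : Lp ℂ 1 (volume : Measure (EuclideanSpace ℝ (Fin d)))) :
    evalOp hs x G = invFourierInt (fun ξ => ((weight s ξ)⁻¹ : ℝ) * G ξ) x := by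
  rw [evalOp, kernelOp_apply, invFourierInt]
  refine integral_congr_ae (Eventually.of_forall fun ξ => ?_)
  simp only [smul_eq_mul]
  ring

/-- The weights cancel and translation by η becomes the character e^{ix·η}. This is the convolution
theorem one η at a time, so no convolution has to be formed. -/
theorem evalOp_potentialKernel (hs : 0 ≤ s) (hw : Integrable fun ξ => (weight s ξ : ℂ) * w ξ)
    (x η : EuclideanSpace ℝ (Fin d)) :
    evalOp hs x (potentialKernel α hs hw η)
      = (resolventSymbol s α η : ℂ) * Complex.exp (Complex.I * ((inner ℝ x η : ℝ) : ℂ))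
        * invFourierInt w x := by
  rw [evalOp_apply, invFourierInt, invFourierInt, ← integral_const_mul]
  refine (integral_congr_ae ?_).trans (integral_sub_right_eq_self _ η)
  filter_upwards [potentialKernel_ae_eq (α := α) hs hw η] with ξ hξ
  have : (weight s ξ : ℂ) ≠ 0 := by exact_mod_cast (weight_pos s ξ).ne'
  rw [hξ, inner_sub_right, Complex.ofReal_sub, mul_sub, Complex.exp_sub, Complex.ofReal_inv]
  field_simp [Complex.exp_ne_zero]

theorem evalOp_potentialOp (hα : 0 < α) (hs : 0 ≤ s)
    (hw : Integrable fun ξ => (weight s ξ : ℂ) * w ξ) (x : EuclideanSpace ℝ (Fin d))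
    (G : Lp ℂ 1 (volume : Measure (EuclideanSpace ℝ (Fin d)))) :
    evalOp hs x (potentialOp hα hs hw G)
      = invFourierInt (fun ξ => (resolventSymbol s α ξ : ℂ) * G ξ) x * invFourierInt w x := by
  rw [potentialOp, map_kernelOp]
  conv_rhs => rw [invFourierInt, ← integral_mul_const]
  refine integral_congr_ae (Eventually.of_forall fun η => ?_)
  simp only [evalOp_potentialKernel, smul_eq_mul]
  ring

theorem integrable_resolventSymbol_mul (hα : 0 < α)
    (G : Lp ℂ 1 (volume : Measure (EuclideanSpace ℝ (Fin d)))) :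
    Integrable fun ξ => (weight (s + 2) ξ : ℂ) * ((resolventSymbol s α ξ : ℂ) * G ξ) := by
  refine (L1.integrable_coeFn G).norm.const_mul (1 + α⁻¹) |>.mono' ?_
    (Eventually.of_forall fun ξ => ?_)
  · exact (Complex.continuous_ofReal.comp (continuous_weight _)).aestronglyMeasurable.mul
      ((Complex.continuous_ofReal.comp (continuous_resolventSymbol hα)).aestronglyMeasurable.mul
        (L1.integrable_coeFn G).1)
  · rw [← mul_assoc, norm_mul, norm_mul, Complex.norm_real, Complex.norm_real,
      Real.norm_of_nonneg (weight_pos _ _).le, Real.norm_of_nonneg (resolventSymbol_pos hα ξ).le]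
    exact mul_le_mul_of_nonneg_right (weight_add_two_mul_resolventSymbol_le hα ξ) (norm_nonneg _)

theorem integrable_norm_sq_mul (hs : 0 ≤ s) {h : EuclideanSpace ℝ (Fin d) → ℂ}
    (hh : Integrable fun ξ => (weight (s + 2) ξ : ℂ) * h ξ) :
    Integrable fun ξ => ((‖ξ‖ ^ 2 : ℝ) : ℂ) * h ξ := by
  refine hh.mono ?_ (Eventually.of_forall fun ξ => ?_)
  · exact (Continuous.aestronglyMeasurable (by fun_prop)).mul
      (integrable_of_weight_mul (by linarith : 0 ≤ s + 2) hh).1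
  · rw [norm_mul, norm_mul, Complex.norm_real, Complex.norm_real,
      Real.norm_of_nonneg (weight_pos _ _).le, Real.norm_of_nonneg (sq_nonneg _), weight_add_two]
    refine mul_le_mul_of_nonneg_right ?_ (norm_nonneg _)
    nlinarith [one_le_weight hs ξ, sq_nonneg ‖ξ‖]

/-- The factor |ξ|² + α cancels the one in `resolventSymbol`, leaving 1/`weight s`. -/
theorem evalOp_eq_neg_laplacian_add (hα : 0 < α) (hs : 0 ≤ s) (x : EuclideanSpace ℝ (Fin d))
    (G : Lp ℂ 1 (volume : Measure (EuclideanSpace ℝ (Fin d)))) :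
    evalOp hs x G
      = invFourierInt (fun ξ => ((‖ξ‖ ^ 2 : ℝ) : ℂ) * ((resolventSymbol s α ξ : ℂ) * G ξ)) x
        + α * invFourierInt (fun ξ => (resolventSymbol s α ξ : ℂ) * G ξ) x := by
  have hi := integrable_resolventSymbol_mul (s := s) hα G
  have hi1 := integrable_of_weight_mul (by linarith : 0 ≤ s + 2) hi
  rw [← invFourierInt_const_mul, ← Pi.add_apply (invFourierInt _), ← invFourierInt_add
    (integrable_norm_sq_mul hs hi) (hi1.const_mul _), evalOp_apply]
  congr 1
  ext ξ
  have h1 : (weight s ξ : ℂ) ≠ 0 := by exact_mod_cast (weight_pos s ξ).ne'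
  have h2 : ((‖ξ‖ : ℂ) ^ 2 + α) ≠ 0 := by
    exact_mod_cast (by positivity : 0 < ‖ξ‖ ^ 2 + α).ne'
  simp only [Pi.add_apply, resolventSymbol]
  push_cast
  field_simp

theorem exists_solution_operator (hd : 1 ≤ d) (hα : 0 < α) (hs : 0 ≤ s)
    (hw : Integrable fun ξ => (weight s ξ : ℂ) * w ξ) {q : EuclideanSpace ℝ (Fin d) → ℝ}
    (hq : ∀ x, 0 ≤ q x) (hqw : ∀ x, (q x : ℂ) = α + invFourierInt w x) :
    ∃ C : ℝ≥0, ∀ k : EuclideanSpace ℝ (Fin d) → ℂ,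
      (Integrable fun ξ => (weight s ξ : ℂ) * k ξ) →
      ∃ h : EuclideanSpace ℝ (Fin d) → ℂ, (Integrable fun ξ => (weight (s + 2) ξ : ℂ) * h ξ) ∧
        (∫⁻ ξ, ‖(weight (s + 2) ξ : ℂ) * h ξ‖ₑ ≤ C * ∫⁻ ξ, ‖(weight s ξ : ℂ) * k ξ‖ₑ) ∧
        ∀ x, invFourierInt (fun ξ => ((‖ξ‖ ^ 2 : ℝ) : ℂ) * h ξ) x + (q x : ℂ) * invFourierInt h x
          = invFourierInt k x := by
  have heval : ∀ x G, evalOp hs x (G + potentialOp hα hs hw G)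
      = invFourierInt (fun ξ => ((‖ξ‖ ^ 2 : ℝ) : ℂ) * ((resolventSymbol s α ξ : ℂ) * G ξ)) x
        + (q x : ℂ) * invFourierInt (fun ξ => (resolventSymbol s α ξ : ℂ) * G ξ) x := fun x G => by
    rw [map_add, evalOp_potentialOp, evalOp_eq_neg_laplacian_add hα, hqw]
    ring
  have hinj : ∀ G, G + potentialOp hα hs hw G = 0 → G = 0 := fun G hG => by
    have hi := integrable_resolventSymbol_mul (s := s) hα G
    have h0 := ae_eq_zero_of_schrodinger_eq_zero hd
      (integrable_of_weight_mul (by linarith : 0 ≤ s + 2) hi) (integrable_norm_sq_mul hs hi) hq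
      (fun x => by rw [← heval, hG, map_zero])
    refine Lp.eq_zero_iff_ae_eq_zero.2 ?_
    filter_upwards [h0] with ξ hξ
    have : (resolventSymbol s α ξ : ℂ) ≠ 0 := by exact_mod_cast (resolventSymbol_pos hα ξ).ne'
    simpa [this] using hξ
  have hres : (-1 : ℂ) ∈ resolventSet ℂ (potentialOp hα hs hw) := by
    refine ((isCompactOperator_potentialOp hα hs hw).hasEigenvalue_or_mem_resolventSet
      (neg_ne_zero.2 one_ne_zero)).resolve_left fun hev => ?_
    obtain ⟨G, hG⟩ := hev.exists_hasEigenvector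
    refine hG.2 (hinj G ?_)
    have := hG.apply_eq_smul
    rw [ContinuousLinearMap.coe_coe] at this
    rw [this, neg_one_smul, add_neg_cancel]
  -- `A` inverts -1 - T, so -A inverts 1 + T; a right inverse is enough for existence.
  obtain ⟨A, hA⟩ := (spectrum.mem_resolventSet_iff.1 hres).exists_right_inv
  have hsolve : ∀ F, -(A F) + potentialOp hα hs hw (-(A F)) = F := fun F => by
    have := congrArg (fun T => T F) hA
    simpa [sub_eq_add_neg] using this
  -- The first factor bounds the passage from G to h, the second that from k to G.
  refine ⟨Real.toNNReal (1 + α⁻¹) * ‖A‖₊, fun k hk => ?_⟩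
  set G := -(A (hk.toL1 _)) with hG
  refine ⟨fun ξ => (resolventSymbol s α ξ : ℂ) * G ξ, integrable_resolventSymbol_mul hα G, ?_,
    fun x => ?_⟩
  · calc ∫⁻ ξ, ‖(weight (s + 2) ξ : ℂ) * ((resolventSymbol s α ξ : ℂ) * G ξ)‖ₑ
        ≤ ∫⁻ ξ, (Real.toNNReal (1 + α⁻¹) : ℝ≥0∞) * ‖G ξ‖ₑ := by
          refine lintegral_mono fun ξ => ?_
          rw [← mul_assoc, enorm_mul]
          refine mul_le_mul_left ?_ _
          rw [← ofReal_norm, ← ENNReal.ofReal, norm_mul, Complex.norm_real, Complex.norm_real,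
            Real.norm_of_nonneg (weight_pos _ _).le,
            Real.norm_of_nonneg (resolventSymbol_pos hα ξ).le]
          exact ENNReal.ofReal_le_ofReal (weight_add_two_mul_resolventSymbol_le hα ξ)
      _ = (Real.toNNReal (1 + α⁻¹) : ℝ≥0∞) * ‖G‖ₑ := by
          rw [lintegral_const_mul' _ _ ENNReal.coe_ne_top, Lp.enorm_def,
            eLpNorm_one_eq_lintegral_enorm]
      _ ≤ (Real.toNNReal (1 + α⁻¹) : ℝ≥0∞) * (‖A‖₊ * ‖hk.toL1 _‖ₑ) := by
          gcongr
          rw [hG, enorm_neg]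
          exact A.le_opENorm _
      _ = _ := by
          rw [ENNReal.coe_mul, mul_assoc, Integrable.enorm_toL1]
  · have hx := heval x G
    rw [hsolve, evalOp_apply] at hx
    rw [← hx]
    refine congrFun (invFourierInt_congr_ae ?_) x
    filter_upwards [hk.coeFn_toL1] with ξ hξ
    have : (weight s ξ : ℂ) ≠ 0 := by exact_mod_cast (weight_pos s ξ).ne'
    rw [hξ, Complex.ofReal_inv, inv_mul_cancel_left₀ this]

end Kernel

/-! ### Hermitian symmetrisation -/

section Real

/-- The Hermitian part of `h`, whose inverse Fourier transform is the real part of that of `h`. -/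
def hermitianPart (h : EuclideanSpace ℝ (Fin d) → ℂ) (ξ : EuclideanSpace ℝ (Fin d)) : ℂ :=
  2⁻¹ * (h ξ + (starRingEnd ℂ) (h (-ξ)))

theorem integrable_conj_neg {h : EuclideanSpace ℝ (Fin d) → ℂ} (hh : Integrable h) :
    Integrable fun ξ => (starRingEnd ℂ) (h (-ξ)) :=
  Complex.conjLIE.toContinuousLinearEquiv.toContinuousLinearMap.integrable_comp hh.comp_neg

theorem integrable_hermitianPart {h : EuclideanSpace ℝ (Fin d) → ℂ} (hh : Integrable h) :
    Integrable (hermitianPart h) :=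
  (hh.add (integrable_conj_neg hh)).const_mul _

theorem hermitianPart_mul {c : EuclideanSpace ℝ (Fin d) → ℝ} (hc : ∀ ξ, c (-ξ) = c ξ)
    (h : EuclideanSpace ℝ (Fin d) → ℂ) :
    (fun ξ => (c ξ : ℂ) * hermitianPart h ξ) = hermitianPart fun ξ => (c ξ : ℂ) * h ξ := by
  ext ξ
  simp only [hermitianPart, map_mul, Complex.conj_ofReal, hc]
  ring

theorem invFourierInt_conj_neg (h : EuclideanSpace ℝ (Fin d) → ℂ) (x : EuclideanSpace ℝ (Fin d)) :
    invFourierInt (fun ξ => (starRingEnd ℂ) (h (-ξ))) x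
      = (starRingEnd ℂ) (invFourierInt h x) := by
  rw [invFourierInt, invFourierInt, ← integral_conj, ← integral_neg_eq_self]
  refine integral_congr_ae (Eventually.of_forall fun ξ => ?_)
  simp [← Complex.exp_conj]

theorem invFourierInt_hermitianPart {h : EuclideanSpace ℝ (Fin d) → ℂ} (hh : Integrable h)
    (x : EuclideanSpace ℝ (Fin d)) :
    invFourierInt (hermitianPart h) x = ((invFourierInt h x).re : ℂ) := by
  rw [show hermitianPart h = fun ξ => 2⁻¹ * (h + fun ξ => (starRingEnd ℂ) (h (-ξ))) ξ from rfl,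
    invFourierInt_const_mul, invFourierInt_add hh (integrable_conj_neg hh), Pi.add_apply,
    invFourierInt_conj_neg, Complex.add_conj]
  push_cast
  ring

/-- Reflection and conjugation preserve the L¹ norm, so averaging does not increase it. -/
theorem lintegral_enorm_hermitianPart_le {h : EuclideanSpace ℝ (Fin d) → ℂ} (hh : Integrable h) :
    ∫⁻ ξ, ‖hermitianPart h ξ‖ₑ ≤ ∫⁻ ξ, ‖h ξ‖ₑ := by
  have e : ∀ {k : EuclideanSpace ℝ (Fin d) → ℂ}, Integrable k →
      ∫⁻ ξ, ‖k ξ‖ₑ = ENNReal.ofReal (∫ ξ, ‖k ξ‖) := fun hk =>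
    (ofReal_integral_norm_eq_lintegral_enorm hk).symm
  rw [e hh, e (integrable_hermitianPart hh)]
  refine ENNReal.ofReal_le_ofReal ?_
  have hneg : ∫ ξ, ‖h (-ξ)‖ = ∫ ξ, ‖h ξ‖ := integral_neg_eq_self (fun ξ => ‖h ξ‖) volume
  calc ∫ ξ, ‖hermitianPart h ξ‖ ≤ ∫ ξ, 2⁻¹ * (‖h ξ‖ + ‖h (-ξ)‖) := by
        refine integral_mono (integrable_hermitianPart hh).norm
          ((hh.norm.add hh.comp_neg.norm).const_mul _) fun ξ => ?_
        simp only [hermitianPart, norm_mul, norm_inv, Complex.norm_ofNat]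
        gcongr
        refine (norm_add_le _ _).trans_eq ?_
        rw [RCLike.norm_conj]
    _ = ∫ ξ, ‖h ξ‖ := by
        rw [integral_const_mul, integral_add hh.norm hh.comp_neg.norm, hneg]
        ring

end Real

/-! ### Weak formulation and continuous representatives -/

section WeakForm

/-- `-Δu + q u` for `u = invFourierInt k`, written on the Fourier side. -/
def schrodinger (q : EuclideanSpace ℝ (Fin d) → ℝ) (k : EuclideanSpace ℝ (Fin d) → ℂ)
    (x : EuclideanSpace ℝ (Fin d)) : ℂ :=
  invFourierInt (fun ξ => ((‖ξ‖ ^ 2 : ℝ) : ℂ) * k ξ) x + (q x : ℂ) * invFourierInt k x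

variable {q V : EuclideanSpace ℝ (Fin d) → ℝ} {k : EuclideanSpace ℝ (Fin d) → ℂ}

theorem continuous_schrodinger (hqc : Continuous q) (hk : Integrable k)
    (hk2 : Integrable fun ξ => ((‖ξ‖ ^ 2 : ℝ) : ℂ) * k ξ) : Continuous (schrodinger q k) :=
  (continuous_invFourierInt hk2).add
    ((Complex.continuous_ofReal.comp hqc).mul (continuous_invFourierInt hk))

/-- The weak form of `-Δv + V v` for `v` with Fourier transform `k`. -/
theorem integral_weak_form (hqc : Continuous q) (hVq : V =ᵐ[volume] q) (hk : Integrable k)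
    (hk2 : Integrable fun ξ => ((‖ξ‖ ^ 2 : ℝ) : ℂ) * k ξ) {v : EuclideanSpace ℝ (Fin d) → ℝ}
    (hv : (fun x => (v x : ℂ)) =ᵐ[volume] invFourierInt k) {φ : EuclideanSpace ℝ (Fin d) → ℝ}
    (hφ : ContDiff ℝ ∞ φ) (hφc : HasCompactSupport φ) :
    ((∫ x, (-(v x * Laplacian.laplacian φ x) + V x * v x * φ x) : ℝ) : ℂ)
      = ∫ x, schrodinger q k x * (φ x : ℂ) := by
  have hLc : Continuous fun x => invFourierInt k x * ((Laplacian.laplacian φ x : ℝ) : ℂ) := by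
    refine (continuous_invFourierInt hk).mul (Complex.continuous_ofReal.comp ?_)
    rw [InnerProductSpace.laplacian_eq_iteratedFDeriv_stdOrthonormalBasis]
    refine continuous_finsetSum _ fun i _ => ?_
    have := ((contDiff_infty.1 hφ 2).continuous_iteratedFDeriv (m := 2) le_rfl)
    fun_prop
  have hLi : Integrable fun x => invFourierInt k x * ((Laplacian.laplacian φ x : ℝ) : ℂ) := by
    refine hLc.integrable_of_hasCompactSupport ?_
    refine HasCompactSupport.mul_left (HasCompactSupport.comp_left
      (g := fun t : ℝ => (t : ℂ)) ?_ Complex.ofReal_zero)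
    rw [InnerProductSpace.laplacian_eq_iteratedFDeriv_stdOrthonormalBasis]
    refine (hφc.iteratedFDeriv (𝕜 := ℝ) 2).mono' fun x hx => ?_
    contrapose! hx
    simp [image_eq_zero_of_notMem_tsupport hx]
  have hφi : HasCompactSupport fun x => (φ x : ℂ) :=
    hφc.comp_left (g := fun t : ℝ => (t : ℂ)) Complex.ofReal_zero
  have hφC : Continuous fun x => (φ x : ℂ) := Complex.continuous_ofReal.comp hφ.continuous
  have hN : Integrable fun x =>
      invFourierInt (fun ξ => ((‖ξ‖ ^ 2 : ℝ) : ℂ) * k ξ) x * (φ x : ℂ) :=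
    ((continuous_invFourierInt hk2).mul hφC).integrable_of_hasCompactSupport hφi.mul_left
  have hQ : Integrable fun x => (q x : ℂ) * invFourierInt k x * (φ x : ℂ) :=
    (((Complex.continuous_ofReal.comp hqc).mul
      (continuous_invFourierInt hk)).mul hφC).integrable_of_hasCompactSupport hφi.mul_left
  rw [← integral_complex_ofReal]
  calc ∫ x, ((-(v x * Laplacian.laplacian φ x) + V x * v x * φ x : ℝ) : ℂ)
      = ∫ x, (-(invFourierInt k x * ((Laplacian.laplacian φ x : ℝ) : ℂ))
          + (q x : ℂ) * invFourierInt k x * (φ x : ℂ)) := by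
        refine integral_congr_ae ?_
        filter_upwards [hv, hVq] with x hx hVx
        rw [← hx, hVx]
        push_cast
        ring
    _ = ∫ x, schrodinger q k x * (φ x : ℂ) := by
        rw [integral_add (f := fun x => -(invFourierInt k x * ((Laplacian.laplacian φ x : ℝ) : ℂ)))
          hLi.neg hQ, integral_neg, integral_invFourierInt_mul_laplacian hk hk2 hφ hφc,
          neg_neg, ← integral_add hN hQ]
        simp only [schrodinger, add_mul]

theorem ae_eq_re_invFourierInt {v : EuclideanSpace ℝ (Fin d) → ℝ}
    (hv : (fun x => (v x : ℂ)) =ᵐ[volume] invFourierInt k) :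
    v =ᵐ[volume] fun x => (invFourierInt k x).re := by
  filter_upwards [hv] with x hx
  rw [← hx, Complex.ofReal_re]

theorem locallyIntegrable_of_ae_eq {u v : EuclideanSpace ℝ (Fin d) → ℝ} (hv : Continuous v)
    (huv : u =ᵐ[volume] v) : LocallyIntegrable u :=
  hv.locallyIntegrable.congr huv.symm

end WeakForm

/-- The continuous representative of a potential. -/
theorem PotentialAssumption.exists_symbol {s : ℝ} (hs : 0 ≤ s) {V : EuclideanSpace ℝ (Fin d) → ℝ}
    (hV : PotentialAssumption s V) :
    ∃ (α : ℝ) (w : EuclideanSpace ℝ (Fin d) → ℂ) (q : EuclideanSpace ℝ (Fin d) → ℝ), 0 < α ∧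
      (Integrable fun ξ => (weight s ξ : ℂ) * w ξ) ∧ Continuous q ∧ (∀ x, 0 ≤ q x) ∧
      (∀ x, (q x : ℂ) = α + invFourierInt w x) ∧ V =ᵐ[volume] q := by
  obtain ⟨hV0, α, hα, W, hW, hVW⟩ := hV
  obtain ⟨w, hWw, hwi⟩ := mem_barronSpace_iff.1 hW
  have hw := integrable_of_weight_mul hs hwi
  have hae := hWw.ae_eq_invFourierInt hw
  have hc := continuous_invFourierInt hw
  have him : (fun x => (invFourierInt w x).im) = fun _ => 0 := by
    refine ((Complex.continuous_im.comp hc).ae_eq_iff_eq volume continuous_const).1 ?_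
    filter_upwards [hae] with x hx
    rw [Function.comp, ← hx, Complex.ofReal_im]
  have hqc : Continuous fun x => α + (invFourierInt w x).re :=
    continuous_const.add (Complex.continuous_re.comp hc)
  have hVq : V =ᵐ[volume] fun x => α + (invFourierInt w x).re := by
    filter_upwards [ae_eq_re_invFourierInt hae] with x hx
    rw [hVW, hx]
  -- q ≥ 0 is known only almost everywhere; since q and its positive part are continuous and agree
  -- a.e., they agree everywhere.
  have hmax : (fun x => max (α + (invFourierInt w x).re) 0)
      = fun x => α + (invFourierInt w x).re := by
    refine ((hqc.max continuous_const).ae_eq_iff_eq volume hqc).1 ?_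
    filter_upwards [hVq] with x hx
    rw [← hx, max_eq_left (hV0 x)]
  refine ⟨α, w, fun x => α + (invFourierInt w x).re, hα, hwi, hqc,
    fun x => max_eq_left_iff.1 (congrFun hmax x), fun x => ?_, hVq⟩
  rw [Complex.ofReal_add]
  congr 1
  exact Complex.ext (by simp) (by simpa using (congrFun him x).symm)

end SpectralBarron

end

/-! ### The main theorem -/

open SpectralBarron Filter in
theorem theorem2p1 (d : ℕ) (hd : 1 ≤ d) (s : ℝ) (hs : 0 ≤ s)
    (V : EuclideanSpace ℝ (Fin d) → ℝ) (hV : SpectralBarron.PotentialAssumption s V) :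
    ∃ C : ℝ≥0, ∀ f ∈ SpectralBarron.barronSpace d s,
      ∃ u ∈ SpectralBarron.barronSpace d (s + 2),
        SpectralBarron.IsSolution V f u ∧
        (∀ v ∈ SpectralBarron.barronSpace d (s + 2),
          SpectralBarron.IsSolution V f v → v =ᵐ[volume] u) ∧
        SpectralBarron.barronNorm (s + 2) u ≤ (C : ℝ≥0∞) * SpectralBarron.barronNorm s f := by
  have hs2 : 0 ≤ s + 2 := by linarith
  obtain ⟨α, w, q, hα, hw, hqc, hq, hqw, hVq⟩ := hV.exists_symbol hs
  obtain ⟨C, hC⟩ := exists_solution_operator hd hα hs hw hq hqw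
  refine ⟨C, fun f hf => ?_⟩
  obtain ⟨k, hfk, hki⟩ := mem_barronSpace_iff.1 hf
  have hk := integrable_of_weight_mul hs hki
  have hfae := hfk.ae_eq_invFourierInt hk
  obtain ⟨h, hhi, hbound, heq⟩ := hC k hki
  have hh := integrable_of_weight_mul hs2 hhi
  have hh2 := integrable_norm_sq_mul hs hhi
  have hp := integrable_hermitianPart hh
  have hpi : Integrable fun ξ => (weight (s + 2) ξ : ℂ) * hermitianPart h ξ := by
    rw [hermitianPart_mul (weight_neg _)]
    exact integrable_hermitianPart hhi
  have hp2 := integrable_norm_sq_mul hs hpi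
  -- V and f are real, so the real part of the complex solution is again a solution.
  let u : EuclideanSpace ℝ (Fin d) → ℝ := fun x => (invFourierInt h x).re
  have hu : (fun x => (u x : ℂ)) = invFourierInt (hermitianPart h) :=
    funext fun x => (invFourierInt_hermitianPart hh x).symm
  have huc : Continuous u := Complex.continuous_re.comp (continuous_invFourierInt hh)
  have huF : IsFourierTransform (fun x => (u x : ℂ)) (hermitianPart h) :=
    isFourierTransform_of_ae_eq hp (EventuallyEq.of_eq hu)
  have hschr : ∀ x, schrodinger q (hermitianPart h) x = ((invFourierInt k x).re : ℂ) := fun x => by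
    have := congrArg (fun z : ℂ => (z.re : ℂ)) (heq x)
    simp only [Complex.add_re, Complex.re_ofReal_mul] at this
    rw [schrodinger, hermitianPart_mul (c := fun ξ => ‖ξ‖ ^ 2) (fun ξ => by rw [norm_neg]),
      invFourierInt_hermitianPart hh2, invFourierInt_hermitianPart hh, ← this]
    push_cast
    ring
  have hf_int : ∀ φ : EuclideanSpace ℝ (Fin d) → ℝ,
      ((∫ x, f x * φ x : ℝ) : ℂ) = ∫ x, schrodinger q (hermitianPart h) x * (φ x : ℂ) := fun φ => by
    rw [← integral_complex_ofReal]
    refine integral_congr_ae ?_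
    filter_upwards [ae_eq_re_invFourierInt hfae] with x hx
    rw [hschr, ← hx, Complex.ofReal_mul]
  refine ⟨u, mem_barronSpace_iff.2 ⟨_, huF, hpi⟩, ⟨huc.locallyIntegrable, ?_, ?_, ?_⟩, ?_, ?_⟩
  · refine locallyIntegrable_of_ae_eq (hqc.mul huc) ?_
    filter_upwards [hVq] with x hx
    rw [hx, Pi.mul_apply]
  · exact locallyIntegrable_of_ae_eq (Complex.continuous_re.comp (continuous_invFourierInt hk))
      (ae_eq_re_invFourierInt hfae)
  · intro φ hφ hφc
    have := integral_weak_form hqc hVq hp hp2 (EventuallyEq.of_eq hu) hφ hφc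
    rw [← hf_int] at this
    exact_mod_cast this
  · rintro v hv ⟨-, -, -, hsol⟩
    obtain ⟨m, hvm, hmi⟩ := mem_barronSpace_iff.1 hv
    have hm := integrable_of_weight_mul hs2 hmi
    have hm2 := integrable_norm_sq_mul hs hmi
    have hvae := hvm.ae_eq_invFourierInt hm
    have hcm := continuous_schrodinger hqc hm hm2
    have hcp := continuous_schrodinger hqc hp hp2
    -- Both continuous functions act on test functions as f, hence coincide pointwise; this gives
    -- the pointwise equation required by the maximum principle.
    have hsame : schrodinger q m = schrodinger q (hermitianPart h) := by
      refine (hcm.ae_eq_iff_eq volume hcp).1 ?_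
      refine ae_eq_of_integral_contDiff_smul_eq hcm.locallyIntegrable hcp.locallyIntegrable
        fun φ hφ hφc => ?_
      have := integral_weak_form hqc hVq hm hm2 hvae hφ hφc
      rw [hsol φ hφ hφc, hf_int] at this
      simpa [mul_comm] using this.symm
    have hdiff : m - hermitianPart h =ᵐ[volume] 0 := by
      have e : ∀ {a b : EuclideanSpace ℝ (Fin d) → ℂ}, Integrable a → Integrable b → ∀ x,
          invFourierInt (a - b) x = invFourierInt a x - invFourierInt b x := fun ha hb x => by
        have := congrFun (invFourierInt_add (ha.sub hb) hb) x
        rw [sub_add_cancel, Pi.add_apply] at this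
        rw [this, add_sub_cancel_right]
      have emul : (fun ξ => ((‖ξ‖ ^ 2 : ℝ) : ℂ) * (m - hermitianPart h) ξ)
          = (fun ξ => ((‖ξ‖ ^ 2 : ℝ) : ℂ) * m ξ)
            - fun ξ => ((‖ξ‖ ^ 2 : ℝ) : ℂ) * hermitianPart h ξ := by
        ext ξ
        simp [mul_sub]
      refine ae_eq_zero_of_schrodinger_eq_zero hd (hm.sub hp) ?_ hq fun x => ?_
      · rw [emul]
        exact hm2.sub hp2
      · have := congrFun hsame x
        simp only [schrodinger] at this
        rw [emul, e hm2 hp2, e hm hp]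
        linear_combination this
    have hmp : m =ᵐ[volume] hermitianPart h := by
      filter_upwards [hdiff] with ξ hξ
      exact sub_eq_zero.1 hξ
    filter_upwards [hvae] with x hx
    rw [invFourierInt_congr_ae hmp, ← hu] at hx
    exact Complex.ofReal_injective hx
  · rw [barronNorm_eq huF, barronNorm_eq hfk]
    simp only [fun ξ => congrFun (hermitianPart_mul (weight_neg (s + 2)) h) ξ]
    exact (lintegral_enorm_hermitianPart_le hhi).trans hbound
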